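/- **Setting.** Let $\mathbb K$ be a commutative ring in which $2$ and $3$ are invertible, and let $(V^+,V^-)$ be a linear Jordan pair over $\mathbb K$, i.e. a pair of $\mathbb K$-modules with trilinear maps $T^\pm:V^\pm\times V^\mp\times V^\pm\to V^\pm$ satisfying $T^\pm(x,y,z)=T^\pm(z,y,x)$ and $$T^\pm(u,v,T^\pm(x,y,z))=T^\pm(T^\pm(u,v,x),y,z)-T^\pm(x,T^\mp(v,u,y),z)+T^\pm(x,y,T^\pm(u,v,z)).$$ Let $\mathfrak g=\mathfrak g_1\oplus\mathfrak g_0\oplus\mathfrak g_{-1}$ be the associated 3-graded Lie algebra, with $\mathfrak g_{\pm1}=V^\pm$, $\mathfrak g_0$ the derivations of the Jordan pair (it contains the Euler operator $(\mathrm{id},-\mathrm{id})$), and $T^\pm(x,y,z)=[[x,y],z]$. Let $G$ be the group of automorphisms of $\mathfrak g$ generated by $U^\pm=\exp(\operatorname{ad}V^\pm)$, let $H\subset G$ be the subgroup of elements preserving the grading, $P^\pm=U^\pm H$, $\mathcal X^+=G/P^-$, $\mathcal X^-=G/P^+$, with base points $o^+,o^-$. Write $x\top a$ ($x\in\mathcal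 X^+$, $a\in\mathcal X^-$) if $(x,a)=g(o^+,o^-)$ for some $g\in G$, and put $\mathfrak v_a=\{x\in\mathcal X^+: x\top a\}$, $\mathfrak v_x=\{a\in\mathcal X^-: x\top a\}$. If $(x,a)=g(o^+,o^-)$, the chart $v\mapsto g\exp(v)o^+$ identifies $V^+$ with $\mathfrak v_a$ and makes $\mathfrak v_a$ a $\mathbb K$-module with zero vector $x$; for $r\in\mathbb K$, $y\in\mathfrak v_a$ let $\mathbf\Pi_r(x,a,y)=r_{x,a}(y)$ be $r\cdot y$ in this module. Dually, $\mathfrak v_x$ is a module with zero vector $a$, and $\mathbf\Pi_r(a,x,b)$ denotes $r\cdot b$ in it, for $b\in\mathfrak v_x$. For $r$ invertible, $r_{x,a}$ extends to all of $\mathcal X^+$ as the first component of an automorphism of the geometry, namely the one induced by the conjugate under $g$ of the automorphism $(r,1,r^{-1})$ of $\mathfrak g=\mathfrak g_1\oplus\mathfrak g_0\oplus\mathfrak g_{-1}$; $\mathbf\Pi_r(x,a,\cdot)$ also denotes this extension. A set $M\subset\mathcal X^+$ with a product $\mu(x,y)=\sigma_x(y)$ is a *symmetric space* if each $\sigma_x$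 ($x\in M$) preserves $M$, (S1) $\sigma_x(x)=x$, (S2) $\sigma_x^2=\mathrm{id}_M$, (S3) $\sigma_x\sigma_y\sigma_x=\sigma_{\sigma_x(y)}$, and (S4) the tangent map of $\sigma_x$ at $x$ is $-\mathrm{id}$, in the sense that $\sigma_x$ is represented by $v\mapsto -v$ in some chart $v\mapsto g\exp(v)o^+$ centred at $x$. A *polarity* is a bijection $f:\mathcal X^+\to\mathcal X^-$ such that $(f,f^{-1})$ is an isomorphism of $(\mathcal X^+,\mathcal X^-)$ onto the dual geometry $(\mathcal X^-,\mathcal X^+)$ (compatible with transversality, with all dilations $\mathbf\Pi_r$ and with addition in all affine parts) and such that $x\top f(x)$ for some $x$. Its symmetric space is $M^{(f)}=\{x: x\top f(x)\}$ with the product $(x,y)\mapsto(-1)_{x,f(x)}(y)$. **Theorem 3.1.** (1) Let $a,b\in\mathcal X^-$ be such that $\mathcal U_{a,b}:=\mathfrak v_a\cap\mathfrak v_b$ is non-empty, and let $p:\mathcal U_{a,b}\to\mathcal X^-$, $p(x)=\mathbf\Pi_{1/2}(a,x,b)$, be the midpoint map (the midpoint of $a$ and $b$ in the affine space $\mathfrak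 v_x$). Then $x\top p(x)$ for all $x\in\mathcal U_{a,b}$, and $\mathcal U_{a,b}$ is a symmetric space for the product $$\mu(x,y)=(-1)_{x,p(x)}(y)=\mathbf\Pi_{-1}\bigl(x,\mathbf\Pi_{1/2}(a,x,b),y\bigr).$$ (2) Suppose that $(V^+,V^-)=(J,J)$ comes from a unital Jordan algebra $J$ with product $xy$, i.e. $T^\pm(x,y,z)=2\bigl((xy)z+x(yz)-y(xz)\bigr)$. Let $w=\exp(1^+)\exp(-1^-)\exp(1^+)\in G$, where $1^\pm$ is the unit of $J$ seen in $V^\pm$. Then $gP^-\mapsto gwP^+$ is a well-defined bijection $n:\mathcal X^+\to\mathcal X^-$. If $a,b\in\mathcal X^-$ satisfy $n^{-1}(a)\top b$, then $p$ extends to a polarity $f:\mathcal X^+\to\mathcal X^-$; the symmetric space $\mathcal U_{a,b}$ is the symmetric space $M^{(f)}$ (same set, same product); and $\mathcal U_{a,b}$ is isomorphic to the symmetric space $$J^\times=\{x\in J: U_x\in \mathrm{GL}(J)\},\quad \mu(x,y)=U_x(y^{-1}),\qquad U_x=2L_x^2-L_{x^2},\quad y^{-1}=U_y^{-1}y ;$$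 more precisely, for some $g\in G$ with $g\,o^-=b$ the chart $x\mapsto g\exp(x)o^+$ of $\mathfrak v_b$ restricts to an isomorphism from $J^\times$ onto $\mathcal U_{a,b}$. -/

import Mathlib

/-! # Linear Jordan pairs -/

/-- A linear Jordan pair over a commutative ring `K` (in which `2` and `3` will be invertible):
two modules with trilinear maps `Tp : V⁺ × V⁻ × V⁺ → V⁺`, `Tm : V⁻ × V⁺ × V⁻ → V⁻` satisfying
(LJP1) and (LJP2). -/
structure LinearJordanPair (K Vp Vm : Type*) [CommRing K] [AddCommGroup Vp] [AddCommGroup Vm]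
    [Module K Vp] [Module K Vm] where
  Tp : Vp →ₗ[K] Vm →ₗ[K] Vp →ₗ[K] Vp
  Tm : Vm →ₗ[K] Vp →ₗ[K] Vm →ₗ[K] Vm
  symm_p : ∀ x y z, Tp x y z = Tp z y x
  symm_m : ∀ x y z, Tm x y z = Tm z y x
  jordan_p : ∀ u v x y z,
    Tp u v (Tp x y z) = Tp (Tp u v x) y z - Tp x (Tm v u y) z + Tp x y (Tp u v z)
  jordan_m : ∀ u v x y z,
    Tm u v (Tm x y z) = Tm (Tm u v x) y z - Tm x (Tp v u y) z + Tm x y (Tm u v z)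

namespace LinearJordanPair

section TKK

variable {K Vp Vm : Type*} [CommRing K] [AddCommGroup Vp] [AddCommGroup Vm]
  [Module K Vp] [Module K Vm]

/-- The derivations of a Jordan pair: pairs `(A, B) ∈ End V⁺ × End V⁻` acting as derivations on
both triple products.  They are closed under commutators, and are the degree-zero part of the 3-graded Lie algebra
of the pair.  It contains the Euler operator `(id, -id)` and the inner derivations
`(T⁺(x,y), -T⁻(y,x))`, and acts faithfully on `V⁺ × V⁻`. -/
def der (P : LinearJordanPair K Vp Vm) :
    Submodule K (Module.End K Vp × Module.End K Vm) where
  carrier := {D |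
    (∀ x y z, D.1 (P.Tp x y z) = P.Tp (D.1 x) y z + P.Tp x (D.2 y) z + P.Tp x y (D.1 z)) ∧
    (∀ x y z, D.2 (P.Tm x y z) = P.Tm (D.2 x) y z + P.Tm x (D.1 y) z + P.Tm x y (D.2 z))}
  add_mem' := by
    rintro a b ⟨h1, h2⟩ ⟨h3, h4⟩
    refine ⟨fun x y z => ?_, fun x y z => ?_⟩
    · simp only [Prod.fst_add, Prod.snd_add, LinearMap.add_apply, map_add, h1, h3]; abel
    · simp only [Prod.fst_add, Prod.snd_add, LinearMap.add_apply, map_add, h2, h4]; abel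
  zero_mem' := by constructor <;> intro x y z <;> simp
  smul_mem' := by
    rintro c a ⟨h1, h2⟩
    refine ⟨fun x y z => ?_, fun x y z => ?_⟩
    · simp [h1]
    · simp [h2]

/-- The commutator of two derivations. -/
def commutator (P : LinearJordanPair K Vp Vm) (D D' : P.der) : P.der :=
  ⟨D.1 * D'.1 - D'.1 * D.1, by
    obtain ⟨a, h1, h2⟩ := D
    obtain ⟨b, h3, h4⟩ := D'
    refine ⟨fun x y z => ?_, fun x y z => ?_⟩
    · simp only [Prod.fst_sub, Prod.snd_sub, Prod.fst_mul, Prod.snd_mul,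
        LinearMap.sub_apply, Module.End.mul_apply, map_add, map_sub, h1, h3]; abel
    · simp only [Prod.fst_sub, Prod.snd_sub, Prod.fst_mul, Prod.snd_mul,
        LinearMap.sub_apply, Module.End.mul_apply, map_add, map_sub, h2, h4]; abel⟩

/-- The inner derivation `D(x,y) = (T⁺(x,y), -T⁻(y,x))`. -/
def innerDer (P : LinearJordanPair K Vp Vm) (x : Vp) (y : Vm) : P.der :=
  ⟨(P.Tp x y, -P.Tm y x), by
    refine ⟨fun u v w => ?_, fun u v w => ?_⟩
    · simp only [P.jordan_p x y, LinearMap.neg_apply, map_neg]; abel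
    · simp only [P.jordan_m y x, LinearMap.neg_apply, map_neg]; abel⟩

/-- The 3-graded Lie algebra `𝔤 = 𝔤₁ ⊕ 𝔤₀ ⊕ 𝔤₋₁` of a Jordan pair, with `𝔤₁ = V⁺`,
`𝔤₀ = der P`, `𝔤₋₁ = V⁻`. -/
@[ext] structure TKK (P : LinearJordanPair K Vp Vm) where
  pos : Vp
  zero : P.der
  neg : Vm

namespace TKK

variable {P : LinearJordanPair K Vp Vm}

/-- A triple of components, as an element of the product module. -/
def equivProd : TKK P ≃ Vp × P.der × Vm where
  toFun a := (a.pos, a.zero, a.neg)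
  invFun a := ⟨a.1, a.2.1, a.2.2⟩

instance : AddCommGroup (TKK P) := equivProd.addCommGroup
instance : Module K (TKK P) := equivProd.module K

@[simp] theorem pos_add (a b : TKK P) : (a + b).pos = a.pos + b.pos := rfl
@[simp] theorem zero_add (a b : TKK P) : (a + b).zero = a.zero + b.zero := rfl
@[simp] theorem neg_add (a b : TKK P) : (a + b).neg = a.neg + b.neg := rfl
@[simp] theorem pos_zero : (0 : TKK P).pos = 0 := rfl
@[simp] theorem zero_zero : (0 : TKK P).zero = 0 := rfl
@[simp] theorem neg_zero : (0 : TKK P).neg = 0 := rfl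
@[simp] theorem pos_neg (a : TKK P) : (-a).pos = -a.pos := rfl
@[simp] theorem zero_neg (a : TKK P) : (-a).zero = -a.zero := rfl
@[simp] theorem neg_neg (a : TKK P) : (-a).neg = -a.neg := rfl
@[simp] theorem pos_smul (c : K) (a : TKK P) : (c • a).pos = c • a.pos := rfl
@[simp] theorem zero_smul (c : K) (a : TKK P) : (c • a).zero = c • a.zero := rfl
@[simp] theorem neg_smul (c : K) (a : TKK P) : (c • a).neg = c • a.neg := rfl

/-- The bracket: `[D,x] = D x` for `D ∈ 𝔤₀` and `x ∈ V^±`, `[x,y] = D(x,y)` for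
`x ∈ V⁺`, `y ∈ V⁻`; `𝔤₁` and `𝔤₋₁` are abelian. -/
instance : Bracket (TKK P) (TKK P) where
  bracket a b :=
    ⟨a.zero.1.1 b.pos - b.zero.1.1 a.pos,
     P.commutator a.zero b.zero + P.innerDer a.pos b.neg - P.innerDer b.pos a.neg,
     a.zero.1.2 b.neg - b.zero.1.2 a.neg⟩

@[simp] theorem pos_lie (a b : TKK P) :
    ⁅a, b⁆.pos = a.zero.1.1 b.pos - b.zero.1.1 a.pos := rfl
@[simp] theorem zero_lie (a b : TKK P) :
    ⁅a, b⁆.zero = P.commutator a.zero b.zero + P.innerDer a.pos b.neg - P.innerDer b.pos a.neg := rfl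
@[simp] theorem neg_lie (a b : TKK P) :
    ⁅a, b⁆.neg = a.zero.1.2 b.neg - b.zero.1.2 a.neg := rfl

theorem der_ext {D D' : P.der} (h1 : ∀ x, D.1.1 x = D'.1.1 x) (h2 : ∀ y, D.1.2 y = D'.1.2 y) :
    D = D' :=
  Subtype.ext (Prod.ext (LinearMap.ext h1) (LinearMap.ext h2))

@[simp] theorem inner_fst (x : Vp) (y : Vm) : (P.innerDer x y).1.1 = P.Tp x y := rfl
@[simp] theorem inner_snd (x : Vp) (y : Vm) : (P.innerDer x y).1.2 = -P.Tm y x := rfl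
@[simp] theorem der_lie_fst (D D' : P.der) (x : Vp) :
    (P.commutator D D').1.1 x = D.1.1 (D'.1.1 x) - D'.1.1 (D.1.1 x) := rfl
@[simp] theorem der_lie_snd (D D' : P.der) (y : Vm) :
    (P.commutator D D').1.2 y = D.1.2 (D'.1.2 y) - D'.1.2 (D.1.2 y) := rfl

instance : LieRing (TKK P) where
  add_lie a b c := by
    ext1
    · simp; abel
    · apply der_ext <;> intro v <;> simp <;> abel
    · simp; abel
  lie_add a b c := by
    ext1
    · simp; abel
    · apply der_ext <;> intro v <;> simp <;> abel
    · simp; abel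
  lie_self a := by
    ext1
    · simp
    · apply der_ext <;> intro v <;> simp
    · simp
  leibniz_lie a b c := by
    ext1
    · simp only [pos_lie, zero_lie, pos_add, map_sub,
        Submodule.coe_add, Submodule.coe_sub, Prod.fst_add,
        Prod.fst_sub, LinearMap.add_apply, LinearMap.sub_apply, der_lie_fst, inner_fst]
      rw [P.symm_p b.pos c.neg a.pos, P.symm_p c.pos b.neg a.pos, P.symm_p c.pos a.neg b.pos]
      abel
    · apply der_ext <;> intro v
      · have h1 := a.zero.2.1; have h2 := b.zero.2.1; have h3 := c.zero.2.1
        simp only [pos_lie, zero_lie, zero_add, neg_lie, map_sub, map_add,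
          Submodule.coe_add, Submodule.coe_sub, Prod.fst_add,
          Prod.fst_sub, LinearMap.add_apply, LinearMap.sub_apply, der_lie_fst, inner_fst,
          h1, h2, h3]
        abel
      · have h1 := a.zero.2.2; have h2 := b.zero.2.2; have h3 := c.zero.2.2
        simp only [pos_lie, zero_lie, zero_add, neg_lie, map_sub, map_add, map_neg,
          Submodule.coe_add, Submodule.coe_sub, Prod.snd_add, LinearMap.neg_apply,
          Prod.snd_sub, LinearMap.add_apply, LinearMap.sub_apply, der_lie_snd, inner_snd,
          h1, h2, h3]
        abel
    · simp only [neg_lie, zero_lie, neg_add, map_sub,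
        Submodule.coe_add, Submodule.coe_sub, Prod.snd_add,
        Prod.snd_sub, LinearMap.add_apply, LinearMap.sub_apply, der_lie_snd, inner_snd,
        LinearMap.neg_apply]
      rw [P.symm_m b.neg c.pos a.neg, P.symm_m c.neg b.pos a.neg, P.symm_m c.neg a.pos b.neg]
      abel

instance : LieAlgebra K (TKK P) where
  lie_smul t a b := by
    ext1
    · simp [smul_sub]
    · apply der_ext <;> intro v <;> simp [smul_sub, smul_add]
    · simp [smul_sub]

/-- The homogeneous component `𝔤₁` of `𝔤`. -/
def gradePos (P : LinearJordanPair K Vp Vm) : Submodule K (TKK P) where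
  carrier := {a | a.zero = 0 ∧ a.neg = 0}
  add_mem' := by rintro a b ⟨h1, h2⟩ ⟨h3, h4⟩; simp [h1, h2, h3, h4]
  zero_mem' := by simp
  smul_mem' := by rintro c a ⟨h1, h2⟩; simp [h1, h2]

/-- The homogeneous component `𝔤₀` of `𝔤`. -/
def gradeZero (P : LinearJordanPair K Vp Vm) : Submodule K (TKK P) where
  carrier := {a | a.pos = 0 ∧ a.neg = 0}
  add_mem' := by rintro a b ⟨h1, h2⟩ ⟨h3, h4⟩; simp [h1, h2, h3, h4]
  zero_mem' := by simp
  smul_mem' := by rintro c a ⟨h1, h2⟩; simp [h1, h2]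

/-- The homogeneous component `𝔤₋₁` of `𝔤`. -/
def gradeNeg (P : LinearJordanPair K Vp Vm) : Submodule K (TKK P) where
  carrier := {a | a.pos = 0 ∧ a.zero = 0}
  add_mem' := by rintro a b ⟨h1, h2⟩ ⟨h3, h4⟩; simp [h1, h2, h3, h4]
  zero_mem' := by simp
  smul_mem' := by rintro c a ⟨h1, h2⟩; simp [h1, h2]

@[simp] theorem mem_gradePos {a : TKK P} : a ∈ gradePos P ↔ a.zero = 0 ∧ a.neg = 0 := Iff.rfl
@[simp] theorem mem_gradeZero {a : TKK P} : a ∈ gradeZero P ↔ a.pos = 0 ∧ a.neg = 0 := Iff.rfl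
@[simp] theorem mem_gradeNeg {a : TKK P} : a ∈ gradeNeg P ↔ a.pos = 0 ∧ a.zero = 0 := Iff.rfl

/-- The inclusion of `V⁺ = 𝔤₁` into `𝔤`. -/
def ofPos (P : LinearJordanPair K Vp Vm) (x : Vp) : TKK P := ⟨x, 0, 0⟩

/-- The inclusion of `V⁻ = 𝔤₋₁` into `𝔤`. -/
def ofNeg (P : LinearJordanPair K Vp Vm) (y : Vm) : TKK P := ⟨0, 0, y⟩

theorem ad_ofPos_cube (x : Vp) (a : TKK P) :
    ⁅ofPos P x, ⁅ofPos P x, ⁅ofPos P x, a⁆⁆⁆ = 0 := by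
  ext1
  · simp [ofPos]
  · apply der_ext <;> intro v <;> simp [ofPos]
  · simp [ofPos]

theorem ad_ofNeg_cube (y : Vm) (a : TKK P) :
    ⁅ofNeg P y, ⁅ofNeg P y, ⁅ofNeg P y, a⁆⁆⁆ = 0 := by
  ext1
  · simp [ofNeg]
  · apply der_ext <;> intro v <;> simp [ofNeg]
  · simp [ofNeg]

theorem ofPos_neg (x : Vp) : ofPos P (-x) = -ofPos P x := by ext1 <;> simp [ofPos]
theorem ofNeg_neg (y : Vm) : ofNeg P (-y) = -ofNeg P y := by ext1 <;> simp [ofNeg]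

variable [Invertible (2 : K)]

/-- `exp(ad x) = id + ad x + ½ (ad x)²` for an element with `(ad x)³ = 0`. -/
def expAd (x : TKK P) (hx : ∀ a : TKK P, ⁅x, ⁅x, ⁅x, a⁆⁆⁆ = 0) : TKK P ≃ₗ[K] TKK P where
  toFun a := a + ⁅x, a⁆ + (⅟2 : K) • ⁅x, ⁅x, a⁆⁆
  invFun a := a - ⁅x, a⁆ + (⅟2 : K) • ⁅x, ⁅x, a⁆⁆
  map_add' a b := by simp only [lie_add, smul_add]; abel
  map_smul' c a := by simp only [lie_smul, smul_add, smul_comm c, RingHom.id_apply]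
  left_inv a := by
    have h2 : (⅟2 : K) • ⁅x, ⁅x, a⁆⁆ + (⅟2 : K) • ⁅x, ⁅x, a⁆⁆ = ⁅x, ⁅x, a⁆⁆ := by
      rw [← add_smul, ← two_mul, mul_invOf_self, one_smul]
    simp only [lie_add, lie_smul, hx, smul_zero, _root_.add_zero]
    nth_rewrite 2 [← h2]
    abel
  right_inv a := by
    have h2 : (⅟2 : K) • ⁅x, ⁅x, a⁆⁆ + (⅟2 : K) • ⁅x, ⁅x, a⁆⁆ = ⁅x, ⁅x, a⁆⁆ := by
      rw [← add_smul, ← two_mul, mul_invOf_self, one_smul]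
    simp only [lie_add, lie_sub, lie_smul, hx, smul_zero, _root_.add_zero, sub_zero]
    nth_rewrite 2 [← h2]
    abel

end TKK

open TKK

/-- `exp(x)` for `x ∈ V⁺`. -/
def expPos (P : LinearJordanPair K Vp Vm) [Invertible (2 : K)] (x : Vp) : TKK P ≃ₗ[K] TKK P :=
  expAd (ofPos P x) (ad_ofPos_cube x)

/-- `exp(y)` for `y ∈ V⁻`. -/
def expNeg (P : LinearJordanPair K Vp Vm) [Invertible (2 : K)] (y : Vm) : TKK P ≃ₗ[K] TKK P :=
  expAd (ofNeg P y) (ad_ofNeg_cube y)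

/-- The projective elementary group `G = PE(V⁺, V⁻)`, generated by `U^± = exp(V^±)`. -/
def PE (P : LinearJordanPair K Vp Vm) [Invertible (2 : K)] : Subgroup (TKK P ≃ₗ[K] TKK P) :=
  Subgroup.closure (Set.range P.expPos ∪ Set.range P.expNeg)

/-- The automorphism group of the 3-graded Lie algebra: Lie algebra automorphisms preserving
each homogeneous component. -/
def gradedAut (P : LinearJordanPair K Vp Vm) : Subgroup (TKK P ≃ₗ[K] TKK P) where
  carrier := {g | (∀ a b, g ⁅a, b⁆ = ⁅g a, g b⁆) ∧
    (gradePos P).map (g : TKK P →ₗ[K] TKK P) = gradePos P ∧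
    (gradeZero P).map (g : TKK P →ₗ[K] TKK P) = gradeZero P ∧
    (gradeNeg P).map (g : TKK P →ₗ[K] TKK P) = gradeNeg P}
  mul_mem' := by
    rintro g h ⟨a0, a1, a2, a3⟩ ⟨b0, b1, b2, b3⟩
    have e : ((g * h : TKK P ≃ₗ[K] TKK P) : TKK P →ₗ[K] TKK P) =
      (g : TKK P →ₗ[K] TKK P) ∘ₗ (h : TKK P →ₗ[K] TKK P) := rfl
    refine ⟨fun a b => ?_, ?_, ?_, ?_⟩
    · simp [LinearEquiv.mul_apply, b0, a0]
    · rw [e, Submodule.map_comp, b1, a1]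
    · rw [e, Submodule.map_comp, b2, a2]
    · rw [e, Submodule.map_comp, b3, a3]
  one_mem' := by
    have e : ((1 : TKK P ≃ₗ[K] TKK P) : TKK P →ₗ[K] TKK P) = LinearMap.id := rfl
    refine ⟨fun a b => rfl, ?_, ?_, ?_⟩ <;> rw [e, Submodule.map_id]
  inv_mem' := by
    rintro g ⟨a0, a1, a2, a3⟩
    have e : ((g⁻¹ : TKK P ≃ₗ[K] TKK P) : TKK P →ₗ[K] TKK P) ∘ₗ (g : TKK P →ₗ[K] TKK P) =
        LinearMap.id := by
      ext a : 1
      exact g.symm_apply_apply a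
    refine ⟨fun a b => ?_, ?_, ?_, ?_⟩
    · apply g.injective
      rw [a0]
      change g (g.symm _) = ⁅g (g.symm _), g (g.symm _)⁆
      simp
    · conv_lhs => rw [← a1]
      rw [← Submodule.map_comp, e, Submodule.map_id]
    · conv_lhs => rw [← a2]
      rw [← Submodule.map_comp, e, Submodule.map_id]
    · conv_lhs => rw [← a3]
      rw [← Submodule.map_comp, e, Submodule.map_id]

/-- The automorphism `(s, id, s⁻¹)` of the 3-graded Lie algebra, for a unit `s`. -/
def gradeScale (P : LinearJordanPair K Vp Vm) (s : Kˣ) : TKK P ≃ₗ[K] TKK P where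
  toFun a := ⟨s • a.pos, a.zero, s⁻¹ • a.neg⟩
  invFun a := ⟨s⁻¹ • a.pos, a.zero, s • a.neg⟩
  map_add' a b := by ext1 <;> simp
  map_smul' c a := by ext1 <;> simp [smul_comm c]
  left_inv a := by simp
  right_inv a := by simp

theorem gradeScale_inv (P : LinearJordanPair K Vp Vm) (s : Kˣ) :
    (P.gradeScale s)⁻¹ = P.gradeScale s⁻¹ := by
  apply LinearEquiv.ext
  intro a
  change (P.gradeScale s).symm a = _
  simp only [gradeScale, inv_inv]
  rfl

theorem gradeScale_mem (P : LinearJordanPair K Vp Vm) (s : Kˣ) :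
    P.gradeScale s ∈ P.gradedAut := by
  refine ⟨fun a b => ?_, ?_, ?_, ?_⟩
  · ext1
    · simp [gradeScale, smul_sub]
    · apply der_ext <;> intro v <;> simp [gradeScale, Units.smul_def, smul_smul]
    · simp [gradeScale, smul_sub]
  all_goals
    ext a
    constructor
    · rintro ⟨b, ⟨h1, h2⟩, rfl⟩
      constructor <;> simp [gradeScale, h1, h2]
    · rintro ⟨h1, h2⟩
      refine ⟨⟨s⁻¹ • a.pos, a.zero, s • a.neg⟩, ?_, ?_⟩
      · constructor <;> simp [h1, h2]
      · ext1 <;> simp [gradeScale]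

theorem gradeScale_conj_expPos (P : LinearJordanPair K Vp Vm) [Invertible (2 : K)] (s : Kˣ)
    (x : Vp) : P.gradeScale s * P.expPos x * (P.gradeScale s)⁻¹ = P.expPos (s • x) := by
  rw [mul_inv_eq_iff_eq_mul]
  apply LinearEquiv.ext
  intro a
  have h : P.gradeScale s (ofPos P x) = ofPos P (s • x) := by
    ext1 <;> simp [gradeScale, ofPos]
  have e := (P.gradeScale_mem s).1
  change P.gradeScale s (a + ⁅ofPos P x, a⁆ + (⅟2 : K) • ⁅ofPos P x, ⁅ofPos P x, a⁆⁆) =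
    P.gradeScale s a + ⁅ofPos P (s • x), P.gradeScale s a⁆ +
      (⅟2 : K) • ⁅ofPos P (s • x), ⁅ofPos P (s • x), P.gradeScale s a⁆⁆
  simp only [map_add, map_smul, e, h]

theorem gradeScale_conj_expNeg (P : LinearJordanPair K Vp Vm) [Invertible (2 : K)] (s : Kˣ)
    (y : Vm) : P.gradeScale s * P.expNeg y * (P.gradeScale s)⁻¹ = P.expNeg (s⁻¹ • y) := by
  rw [mul_inv_eq_iff_eq_mul]
  apply LinearEquiv.ext
  intro a
  have h : P.gradeScale s (ofNeg P y) = ofNeg P (s⁻¹ • y) := by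
    ext1 <;> simp [gradeScale, ofNeg]
  have e := (P.gradeScale_mem s).1
  change P.gradeScale s (a + ⁅ofNeg P y, a⁆ + (⅟2 : K) • ⁅ofNeg P y, ⁅ofNeg P y, a⁆⁆) =
    P.gradeScale s a + ⁅ofNeg P (s⁻¹ • y), P.gradeScale s a⁆ +
      (⅟2 : K) • ⁅ofNeg P (s⁻¹ • y), ⁅ofNeg P (s⁻¹ • y), P.gradeScale s a⁆⁆
  simp only [map_add, map_smul, e, h]

end TKK

/-! # The generalized projective geometry of a Jordan pair -/

section Geometry

variable {K Vp Vm : Type*} [CommRing K] [AddCommGroup Vp] [AddCommGroup Vm]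
  [Module K Vp] [Module K Vm] (P : LinearJordanPair K Vp Vm) [Invertible (2 : K)]

/-- `exp(x)`, `x ∈ V⁺`, as an element of `G`. -/
def uPos (x : Vp) : P.PE := ⟨P.expPos x, Subgroup.subset_closure (Or.inl ⟨x, rfl⟩)⟩

/-- `exp(y)`, `y ∈ V⁻`, as an element of `G`. -/
def uNeg (y : Vm) : P.PE := ⟨P.expNeg y, Subgroup.subset_closure (Or.inr ⟨y, rfl⟩)⟩

/-- The inner structure group `H`: the intersection of `G` with the automorphism group of the
3-grading. -/
def structureGroup : Subgroup P.PE := P.gradedAut.subgroupOf P.PE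

/-- The subgroup `P⁺ = U⁺ H`.  (`H` normalizes `U⁺`, so the product is the subgroup generated by
`U⁺` and `H`.) -/
def paraPos : Subgroup P.PE := Subgroup.closure (Set.range P.uPos) ⊔ P.structureGroup

/-- The subgroup `P⁻ = U⁻ H`. -/
def paraNeg : Subgroup P.PE := Subgroup.closure (Set.range P.uNeg) ⊔ P.structureGroup

/-- `X⁺ = G / P⁻`. -/
abbrev Xp := P.PE ⧸ P.paraNeg

/-- `X⁻ = G / P⁺`. -/
abbrev Xm := P.PE ⧸ P.paraPos

/-- The base point `o⁺ = e P⁻` of `X⁺`. -/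
def op : P.Xp := ((1 : P.PE) : P.PE ⧸ P.paraNeg)

/-- The base point `o⁻ = e P⁺` of `X⁻`. -/
def om : P.Xm := ((1 : P.PE) : P.PE ⧸ P.paraPos)

/-- Transversality `x ⊤ a`: the transversal pairs form the `G`-orbit of the base point
`(o⁺, o⁻)` in `X⁺ × X⁻`. -/
def Transversal (x : P.Xp) (a : P.Xm) : Prop := ∃ g : P.PE, g • P.op = x ∧ g • P.om = a

/-- The affine part `𝔳_a = {x ∈ X⁺ | x ⊤ a}` of `X⁺`. -/
def affinePart (a : P.Xm) : Set P.Xp := {x | P.Transversal x a}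

/-- The affine charts `V⁺ → X⁺`, `v ↦ g exp(v) o⁺` (`g ∈ G`).  The image is the affine part `𝔳_a`
for `a = g o⁻`, and the origin is sent to `x = g o⁺`; the `K`-module `𝔳_a` with zero vector `x`
is `V⁺` transported by this chart. -/
def chartPos (g : P.PE) (v : Vp) : P.Xp := g • P.uPos v • P.op

/-- The affine charts `V⁻ → X⁻`, `w ↦ g exp(w) o⁻` (`g ∈ G`). -/
def chartNeg (g : P.PE) (w : Vm) : P.Xm := g • P.uNeg w • P.om

open Classical in
/-- The structure map `Π_r⁺(x, a, y) = r y`, the multiple being taken in the `K`-module `𝔳_a` with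
zero vector `x`; it is meaningful for `x ⊤ a` and `y ⊤ a`. -/
noncomputable def piPos (r : K) (x : P.Xp) (a : P.Xm) (y : P.Xp) : P.Xp :=
  if h : ∃ z, ∃ (g : P.PE) (v : Vp), g • P.op = x ∧ g • P.om = a ∧
    P.chartPos g v = y ∧ P.chartPos g (r • v) = z then h.choose else y

open Classical in
/-- The structure map `Π_r⁻(a, x, b) = r b`, the multiple being taken in the `K`-module
`𝔳_x ⊂ X⁻` with zero vector `a`; it is meaningful for `x ⊤ a` and `x ⊤ b`. -/
noncomputable def piNeg (r : K) (a : P.Xm) (x : P.Xp) (b : P.Xm) : P.Xm :=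
  if h : ∃ c, ∃ (g : P.PE) (w : Vm), g • P.om = a ∧ g • P.op = x ∧
    P.chartNeg g w = b ∧ P.chartNeg g (r • w) = c then h.choose else b

open Classical in
/-- The structure map `Σ⁺(x, a, y, z) = y + z`, the sum being taken in the `K`-module `𝔳_a` with
zero vector `x`; it is meaningful for `x, y, z ∈ 𝔳_a`. -/
noncomputable def sigmaPos (x : P.Xp) (a : P.Xm) (y z : P.Xp) : P.Xp :=
  if h : ∃ t, ∃ (g : P.PE) (v w : Vp), g • P.op = x ∧ g • P.om = a ∧
    P.chartPos g v = y ∧ P.chartPos g w = z ∧ P.chartPos g (v + w) = t then h.choose else y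

open Classical in
/-- The structure map `Σ⁻(a, x, b, c) = b + c`, the sum being taken in the `K`-module
`𝔳_x ⊂ X⁻` with zero vector `a`; it is meaningful for `a, b, c ∈ 𝔳_x`. -/
noncomputable def sigmaNeg (a : P.Xm) (x : P.Xp) (b c : P.Xm) : P.Xm :=
  if h : ∃ t, ∃ (g : P.PE) (v w : Vm), g • P.om = a ∧ g • P.op = x ∧
    P.chartNeg g v = b ∧ P.chartNeg g w = c ∧ P.chartNeg g (v + w) = t then h.choose else b

/-- Conjugation by the automorphism `(s, id, s⁻¹)` of the 3-graded Lie algebra, as an endomorphism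
of `G`. -/
def scaleConj (s : Kˣ) : P.PE →* P.PE :=
  ((MulAut.conj (P.gradeScale s)).toMonoidHom.comp P.PE.subtype).codRestrict P.PE (by
    rintro ⟨g, hg⟩
    change P.gradeScale s * g * (P.gradeScale s)⁻¹ ∈ P.PE
    have key : P.PE ≤ P.PE.comap (MulAut.conj (P.gradeScale s)).toMonoidHom := by
      refine (Subgroup.closure_le _).2 ?_
      rintro _ (⟨x, rfl⟩ | ⟨y, rfl⟩)
      · change P.gradeScale s * P.expPos x * (P.gradeScale s)⁻¹ ∈ P.PE
        rw [gradeScale_conj_expPos]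
        exact Subgroup.subset_closure (Or.inl ⟨_, rfl⟩)
      · change P.gradeScale s * P.expNeg y * (P.gradeScale s)⁻¹ ∈ P.PE
        rw [gradeScale_conj_expNeg]
        exact Subgroup.subset_closure (Or.inr ⟨_, rfl⟩)
    exact key hg)

theorem scaleConj_uPos (s : Kˣ) (x : Vp) : P.scaleConj s (P.uPos x) = P.uPos (s • x) :=
  Subtype.ext (P.gradeScale_conj_expPos s x)

theorem scaleConj_uNeg (s : Kˣ) (y : Vm) : P.scaleConj s (P.uNeg y) = P.uNeg (s⁻¹ • y) :=
  Subtype.ext (P.gradeScale_conj_expNeg s y)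

theorem paraNeg_le_comap_scaleConj (s : Kˣ) :
    P.paraNeg ≤ P.paraNeg.comap (P.scaleConj s) := by
  refine sup_le ((Subgroup.closure_le _).2 ?_) ?_
  · rintro _ ⟨y, rfl⟩
    change P.scaleConj s (P.uNeg y) ∈ P.paraNeg
    rw [scaleConj_uNeg]
    exact Subgroup.mem_sup_left (Subgroup.subset_closure ⟨_, rfl⟩)
  · intro g hg
    refine Subgroup.mem_sup_right ?_
    change P.gradeScale s * (g : TKK P ≃ₗ[K] TKK P) * (P.gradeScale s)⁻¹ ∈ P.gradedAut
    exact mul_mem (mul_mem (P.gradeScale_mem s) hg) (inv_mem (P.gradeScale_mem s))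

/-- The transformation of `X⁺` induced by the automorphism `(s, id, s⁻¹)` of the 3-graded Lie
algebra: `g P⁻ ↦ (δ g δ⁻¹) P⁻`. -/
def baseDilation (s : Kˣ) : P.Xp → P.Xp :=
  Quotient.map' (P.scaleConj s) (by
    intro g h hgh
    rw [QuotientGroup.leftRel_apply] at hgh ⊢
    rw [← map_inv, ← map_mul]
    exact P.paraNeg_le_comap_scaleConj s hgh)

/-- In the affine part `𝔳_{o⁻} = V⁺`, the base dilation is multiplication by the scalar `s`. -/
theorem baseDilation_chart (s : Kˣ) (v : Vp) :
    P.baseDilation s (P.chartPos 1 v) = P.chartPos 1 ((s : K) • v) := by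
  change ((P.scaleConj s (1 * (P.uPos v * 1)) : P.PE) : P.PE ⧸ P.paraNeg) =
    ((1 * (P.uPos (s • v) * 1) : P.PE) : P.PE ⧸ P.paraNeg)
  simp [scaleConj_uPos]

open Classical in
/-- The dilation `s_{x,a} : X⁺ → X⁺` of a transversal pair `(x, a)` and an invertible scalar `s`:
the automorphism of the geometry which extends `y ↦ Π_s(x, a, y)`, `y ∈ 𝔳_a`, to all of `X⁺`.
If `(x, a) = g (o⁺, o⁻)` it is the conjugate by `g` of the base dilation. -/
noncomputable def dilation (s : Kˣ) (x : P.Xp) (a : P.Xm) (y : P.Xp) : P.Xp :=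
  if h : P.Transversal x a then h.choose • P.baseDilation s (h.choose⁻¹ • y) else y

/-! # Symmetric spaces, polarities -/

/-- `M ⊂ X⁺` is a symmetric space for the multiplication `μ(x, y) = σ_x(y)`: `M` is stable,
(S1)-(S3) hold, and (S4) the tangent map of `σ_x` at `x` is minus the identity, i.e. `σ_x` is
represented by `-id` in some affine chart of `X⁺` centred at `x`. -/
structure IsSymmetricSpace (M : Set P.Xp) (μ : P.Xp → P.Xp → P.Xp) : Prop where
  closed : ∀ x ∈ M, ∀ y ∈ M, μ x y ∈ M
  s1 : ∀ x ∈ M, μ x x = x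
  s2 : ∀ x ∈ M, ∀ y ∈ M, μ x (μ x y) = y
  s3 : ∀ x ∈ M, ∀ y ∈ M, ∀ z ∈ M, μ x (μ y (μ x z)) = μ (μ x y) z
  s4 : ∀ x ∈ M, ∃ g : P.PE, P.chartPos g 0 = x ∧ ∀ v, μ x (P.chartPos g v) = P.chartPos g (-v)

/-- A polarity of `(X⁺, X⁻)`: a bijection `f : X⁺ → X⁻` such that `(f, f⁻¹)` is an isomorphism
onto the dual geometry, i.e. compatible with transversality and with all structure maps, and such
that there is a non-isotropic point. -/
structure IsPolarity (f : P.Xp ≃ P.Xm) : Prop where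
  transversal : ∀ x a, P.Transversal x a ↔ P.Transversal (f.symm a) (f x)
  map_piPos : ∀ (r : K) x a y, P.Transversal x a → P.Transversal y a →
    f (P.piPos r x a y) = P.piNeg r (f x) (f.symm a) (f y)
  map_piNeg : ∀ (r : K) a x b, P.Transversal x a → P.Transversal x b →
    f.symm (P.piNeg r a x b) = P.piPos r (f.symm a) (f x) (f.symm b)
  map_sigmaPos : ∀ x a y z, P.Transversal x a → P.Transversal y a → P.Transversal z a →
    f (P.sigmaPos x a y z) = P.sigmaNeg (f x) (f.symm a) (f y) (f z)
  map_sigmaNeg : ∀ a x b c, P.Transversal x a → P.Transversal x b → P.Transversal x c →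
    f.symm (P.sigmaNeg a x b c) = P.sigmaPos (f.symm a) (f x) (f.symm b) (f.symm c)
  nonisotropic : ∃ x, P.Transversal x (f x)

/-- The set `M^{(f)} = {x ∈ X⁺ | x ⊤ f(x)}` of non-isotropic points of a polarity. -/
def polarSet (f : P.Xp ≃ P.Xm) : Set P.Xp := {x | P.Transversal x (f x)}

/-- The multiplication `μ(x, y) = (-1)_{x, f(x)}(y)` of the symmetric space `M^{(f)}`. -/
noncomputable def polarMul (f : P.Xp ≃ P.Xm) (x y : P.Xp) : P.Xp := P.dilation (-1) x (f x) y

/-- `U_{a,b} = 𝔳_a ∩ 𝔳_b`. -/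
def U (a b : P.Xm) : Set P.Xp := P.affinePart a ∩ P.affinePart b

/-- The midpoint map `p(x) = Π_{1/2}(a, x, b)`: the midpoint of `a` and `b` in `𝔳_x`. -/
noncomputable def midpointMap (a b : P.Xm) (x : P.Xp) : P.Xm := P.piNeg (⅟2 : K) a x b

/-- `μ(x, y) = (-1)_{x, p(x)}(y) = Π_{-1}(x, Π_{1/2}(a, x, b), y)`, where `Π_{-1}(x, p(x), ·)` is
extended from `𝔳_{p(x)}` to all of `X⁺` (a point `y` of `U_{a,b}` need not lie in `𝔳_{p(x)}`). -/
noncomputable def mul (a b : P.Xm) (x y : P.Xp) : P.Xp :=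
  P.dilation (-1) x (P.midpointMap a b x) y

end Geometry

end LinearJordanPair

/-! # Unital Jordan algebras -/

section JordanAlgebra

set_option linter.unusedSectionVars false

variable (K : Type*) {J : Type*} [CommRing K] [NonAssocCommRing J] [Module K J]
  [IsScalarTower K J J] [SMulCommClass K J J]

/-- Left multiplication `L(x)` of a Jordan algebra. -/
def jordanL (x : J) : Module.End K J := LinearMap.mulLeft K x

@[simp] theorem jordanL_apply (x y : J) : jordanL K x y = x * y := rfl

/-- The quadratic operator `U_x = 2 L(x)² - L(x²)`. -/
def jordanU (x : J) : Module.End K J := 2 • (jordanL K x * jordanL K x) - jordanL K (x * x)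

/-- `J^× = {x ∈ J | U_x ∈ GL(J)}`, the set of invertible elements. -/
def jordanUnits (J : Type*) [NonAssocCommRing J] [Module K J] [SMulCommClass K J J] : Set J := {x | IsUnit (jordanU K x)}

/-- The Jordan inverse `x⁻¹ = U_x⁻¹ x`; it is meaningful for `x ∈ J^×`. -/
noncomputable def jordanInv (x : J) : J := Ring.inverse (jordanU K x) x

/-- The multiplication `μ(x, y) = U_x (y⁻¹)` of the quadratic prehomogeneous symmetric space
`J^×`. -/
noncomputable def jordanMul (x y : J) : J := jordanU K x (jordanInv K y)

variable [Invertible (2 : K)]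

theorem jordanL_lie_cyclic [IsCommJordan J] (a b c : J) :
    (jordanL K a * jordanL K (b * c) - jordanL K (b * c) * jordanL K a) +
    (jordanL K b * jordanL K (c * a) - jordanL K (c * a) * jordanL K b) +
    (jordanL K c * jordanL K (a * b) - jordanL K (a * b) * jordanL K c) = 0 := by
  ext d
  have h0 := two_nsmul_lie_lmul_lmul_add_add_eq_zero a b c
  rw [two_nsmul] at h0
  have h : ((a * ((b * c) * d) - (b * c) * (a * d)) + (b * ((c * a) * d) - (c * a) * (b * d)) +
        (c * ((a * b) * d) - (a * b) * (c * d))) +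
      ((a * ((b * c) * d) - (b * c) * (a * d)) + (b * ((c * a) * d) - (c * a) * (b * d)) +
        (c * ((a * b) * d) - (a * b) * (c * d))) = 0 := DFunLike.congr_fun h0 d
  have h' := congrArg (fun t => (⅟2 : K) • t) h
  simp only [← two_smul K, smul_smul, invOf_mul_self, one_smul, smul_zero] at h'
  simpa using h'

theorem jordanL_lie_lie [IsCommJordan J] (a d c : J) :
    (jordanL K a * jordanL K d - jordanL K d * jordanL K a) * jordanL K c -
      jordanL K c * (jordanL K a * jordanL K d - jordanL K d * jordanL K a) =
    jordanL K (a * (d * c) - d * (a * c)) := by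
  have key : ∀ a c d z : J, a * (d * (c * z)) + c * (d * (a * z)) + ((c * a) * d) * z =
      (a * d) * (c * z) + (c * a) * (d * z) + (c * d) * (a * z) := by
    intro a c d z
    have h := DFunLike.congr_fun (jordanL_lie_cyclic K a z c) d
    simp only [LinearMap.add_apply, LinearMap.sub_apply, Module.End.mul_apply, jordanL_apply,
      LinearMap.zero_apply] at h
    rw [← sub_eq_zero, ← h, mul_comm d (c * z), mul_comm d (a * z), mul_comm c z,
      mul_comm ((c * a) * d) z, mul_comm d z, mul_comm (c * d) (a * z),
      mul_comm (a * d) (z * c)]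
    have e : (z * c) * (a * d) = (a * d) * (z * c) := mul_comm _ _
    rw [e]
    abel
  ext z
  have h := congrArg₂ (fun s t : J => s - t) (key a c d z) (key d c a z)
  have e1 : (c * a) * d = d * (a * c) := by rw [mul_comm, mul_comm c a]
  have e2 : (c * d) * a = a * (d * c) := by rw [mul_comm, mul_comm c d]
  rw [mul_comm d a, e1, e2, ← sub_eq_zero] at h
  simp only [LinearMap.sub_apply, Module.End.mul_apply, jordanL_apply, sub_mul, mul_sub]
  rw [← sub_eq_zero, ← h]
  abel

/-- The trilinear product `T(x, y, z) = 2 ((x y) z + x (y z) - y (x z))` of a Jordan algebra, so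
that `½ T(x, a, y)` is the product of the `a`-homotope and `½ T(x, y, x) = U_x y`. -/
def jordanTriple (J : Type*) [NonAssocCommRing J] [Module K J] [IsScalarTower K J J]
    [SMulCommClass K J J] : J →ₗ[K] J →ₗ[K] J →ₗ[K] J :=
  LinearMap.mk₂ K (fun x y => (2 : K) • (jordanL K (x * y) + jordanL K x * jordanL K y -
      jordanL K y * jordanL K x))
    (fun a b c => by
      rw [← smul_add]; congr 1; ext; simp [add_mul, mul_add]; abel)
    (fun r b c => by
      rw [smul_comm r]; congr 1; ext; simp [smul_add, smul_sub, smul_mul_assoc])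
    (fun a b c => by
      rw [← smul_add]; congr 1; ext; simp [add_mul, mul_add]; abel)
    (fun r b c => by
      rw [smul_comm r]; congr 1; ext; simp [smul_add, smul_sub, smul_mul_assoc, mul_smul_comm])

theorem jordanTriple_apply (x y z : J) :
    jordanTriple K J x y z = (2 : K) • ((x * y) * z + x * (y * z) - y * (x * z)) := rfl

theorem jordanTriple_symm (x y z : J) : jordanTriple K J x y z = jordanTriple K J z y x := by
  rw [jordanTriple_apply, jordanTriple_apply, mul_comm (x * y) z, mul_comm (z * y) x,
    mul_comm x z, mul_comm x y, mul_comm y z]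
  congr 1
  abel

theorem jordanTriple_jordan [IsCommJordan J] (u v x y z : J) :
    jordanTriple K J u v (jordanTriple K J x y z) =
      jordanTriple K J (jordanTriple K J u v x) y z - jordanTriple K J x (jordanTriple K J v u y) z
        + jordanTriple K J x y (jordanTriple K J u v z) := by
  -- `jordanTriple` is twice the operator `L(uv) + [L u, L v]`; the second term is a derivation
  let D : Module.End K J := jordanL K u * jordanL K v - jordanL K v * jordanL K u
  have hD : ∀ s t : J, D (s * t) = D s * t + s * D t := by
    intro s t
    have h := DFunLike.congr_fun (jordanL_lie_lie K u v s) t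
    simp only [LinearMap.sub_apply, Module.End.mul_apply, jordanL_apply, sub_mul, mul_sub] at h
    simp only [D, LinearMap.sub_apply, Module.End.mul_apply, jordanL_apply, sub_mul, mul_sub]
    rw [sub_eq_iff_eq_add] at h
    rw [h]
  have hT : ∀ t, jordanTriple K J u v t = (2 : K) • ((u * v) * t + D t) := by
    intro t
    rw [jordanTriple_apply]
    simp only [D, LinearMap.sub_apply, Module.End.mul_apply, jordanL_apply, add_sub_assoc]
  have hT' : ∀ t, jordanTriple K J v u t = (2 : K) • ((u * v) * t - D t) := by
    intro t
    rw [jordanTriple_apply]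
    simp only [D, LinearMap.sub_apply, Module.End.mul_apply, jordanL_apply, mul_comm v u]
    congr 1
    abel
  have hp : ∀ p t : J, p * ((x * y) * t + x * (y * t) - y * (x * t)) =
      (((p * x) * y) * t + (p * x) * (y * t) - y * ((p * x) * t)) -
      ((x * (p * y)) * t + x * ((p * y) * t) - (p * y) * (x * t)) +
      ((x * y) * (p * t) + x * (y * (p * t)) - y * (x * (p * t))) := by
    intro p t
    have h1 := DFunLike.congr_fun (jordanL_lie_cyclic K p x y) t
    have h2 := DFunLike.congr_fun (jordanL_lie_lie K x y p) t
    simp only [LinearMap.add_apply, LinearMap.sub_apply, Module.End.mul_apply, jordanL_apply,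
      LinearMap.zero_apply, mul_sub, sub_mul] at h1 h2
    have e1 : (p * x) * y = y * (x * p) := by rw [mul_comm, mul_comm p x]
    have e2 : x * (p * y) = x * (y * p) := by rw [mul_comm p y]
    rw [mul_comm y p] at h1
    rw [e1, e2, mul_comm p y, mul_comm p x]
    rw [mul_comm p x, mul_comm p y] at h1
    rw [← sub_eq_zero] at h2 ⊢
    have h3 := congrArg₂ (fun s t : J => s - t) h1 h2
    simp only [sub_zero] at h3
    rw [← h3]
    simp only [mul_add, mul_sub]
    abel
  rw [hT, hT, hT, hT']
  simp only [map_smul, map_sub, map_add, LinearMap.smul_apply, LinearMap.sub_apply,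
    LinearMap.add_apply]
  simp only [jordanTriple_apply, map_smul, map_sub, map_add, hD, mul_smul_comm,
    ← smul_add, ← smul_sub]
  congr 2
  rw [hp (u * v) z]
  simp only [mul_add, add_mul]
  abel

/-- The Jordan pair `(J, J)` of a Jordan algebra. -/
def jordanPair (J : Type*) [NonAssocCommRing J] [IsCommJordan J] [Module K J]
    [IsScalarTower K J J] [SMulCommClass K J J] : LinearJordanPair K J J where
  Tp := jordanTriple K J
  Tm := jordanTriple K J
  symm_p := jordanTriple_symm K
  symm_m := jordanTriple_symm K
  jordan_p := jordanTriple_jordan K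
  jordan_m := jordanTriple_jordan K

/-- The element `w = exp(1⁺) exp(-1⁻) exp(1⁺)` of `G`, where `1^±` is the unit element of `J`
viewed in `V^±`. -/
def weyl (J : Type*) [NonAssocCommRing J] [IsCommJordan J] [Module K J]
    [IsScalarTower K J J] [SMulCommClass K J J] : (jordanPair K J).PE :=
  (jordanPair K J).uPos 1 * (jordanPair K J).uNeg (-1) * (jordanPair K J).uPos 1

/-- The canonical identification `n : X⁺ → X⁻` of the geometry of `(J, J)`: the bijection
`g P⁻ ↦ g w P⁺`. -/
def IsCanonicalIdentification {J : Type*} [NonAssocCommRing J] [IsCommJordan J] [Module K J]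
    [IsScalarTower K J J] [SMulCommClass K J J]
    (n : (jordanPair K J).Xp ≃ (jordanPair K J).Xm) : Prop :=
  ∀ g : (jordanPair K J).PE, n (g • (jordanPair K J).op) = g • weyl K J • (jordanPair K J).om

end JordanAlgebra

/-! A transversal pair `(x, a) = g (o⁺, o⁻)` is encoded by its Euler operator `euler x a = g E`, an
element of the Lie algebra. An element of `G` lies in `H` iff it fixes `E`, in `P⁻` iff it moves `E`
into `E + V⁻`, and in `P⁺` iff it moves `E` into `E + V⁺` (`mem_structureGroup_iff`,
`mem_paraNeg_iff`, `mem_paraPos_iff`). Hence `euler` is well defined and determines the pair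
(`Transversal.ext`). With one entry fixed, it is an affine embedding of the corresponding affine
part, so the structure maps become affine combinations of Euler operators (`piNeg_spec`,
`sigmaNeg_spec` and their duals).

The dilation `(-1)_{x,a}` acts on Euler operators by the automorphism `1 - 2 (ad e)²` with `e =
euler x a` (`Transversal.exists_dilation`). At the midpoint `p(x)` one has `e = ½ (euler x a + euler
x b)`, and the reflection in `e` exchanges `euler x a` and `euler x b`. So the symmetry at `x`
exchanges `a` and `b`, preserves `U_{a,b}` and commutes with taking midpoints; since the reflection
in the reflected element is the conjugate reflection, (S3) follows.

For a unital Jordan algebra, `w E = -E`, so `n` acts on Euler operators by `-1`. With `b = g o⁻` and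
`a = g w o⁻`, the polarity is `n` composed with `(-1)_{g o⁺, b}`. In the chart of `g` the Euler
operators of `(v, b)` and `(v, a)` are `g (E - v)` and `g (-E - v⁻¹)`; their mean is the odd element
`-½ g (v, 0, v⁻¹)`, and the reflection in it produces `U_v y⁻¹`. That the polarity has no
non-isotropic points outside `U_{a,b}` is the least formal step: such a point gives an Euler
operator `g (p, 0, q)`, and `two_smul_innerDer_of_odd` forces `2 D(p, q) = E`, after which elements
of `G` realizing `x ⊤ a` and `x ⊤ b` can be written down. -/

namespace LinearJordanPair

/-! ### Automorphisms of the 3-graded Lie algebra and the stabilizers of `E`, `E + V⁻`, `E + V⁺` -/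

section LieAutomorphisms

variable {K Vp Vm : Type*} [CommRing K] [AddCommGroup Vp] [AddCommGroup Vm]
  [Module K Vp] [Module K Vm] {P : LinearJordanPair K Vp Vm}

open TKK (ofPos ofNeg gradePos gradeNeg gradeZero)

theorem smul_two_cancel {R M : Type*} [Semiring R] [Invertible (2 : R)] [AddCommMonoid M]
    [Module R M] {a b : M} (h : (2 : R) • a = (2 : R) • b) : a = b := by
  simpa [smul_smul] using congrArg (fun t => (⅟2 : R) • t) h

theorem smul_three_cancel {R M : Type*} [Semiring R] [Invertible (3 : R)] [AddCommMonoid M]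
    [Module R M] {a b : M} (h : (3 : R) • a = (3 : R) • b) : a = b := by
  simpa [smul_smul] using congrArg (fun t => (⅟3 : R) • t) h

/-- The Euler operator `(id, -id)`. -/
def eulerOp (P : LinearJordanPair K Vp Vm) : TKK P :=
  ⟨0, ⟨(1, -1), by constructor <;> intro x y z <;> simp⟩, 0⟩

@[simp] theorem eulerOp_pos : (eulerOp P).pos = 0 := rfl
@[simp] theorem eulerOp_neg : (eulerOp P).neg = 0 := rfl
@[simp] theorem eulerOp_zero_fst : (eulerOp P).zero.1.1 = 1 := rfl
@[simp] theorem eulerOp_zero_snd : (eulerOp P).zero.1.2 = -1 := rfl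
@[simp] theorem ofPos_pos (x : Vp) : (ofPos P x).pos = x := rfl
@[simp] theorem ofPos_zero (x : Vp) : (ofPos P x).zero = 0 := rfl
@[simp] theorem ofPos_snd (x : Vp) : (ofPos P x).neg = 0 := rfl
@[simp] theorem ofNeg_pos (y : Vm) : (ofNeg P y).pos = 0 := rfl
@[simp] theorem ofNeg_zero (y : Vm) : (ofNeg P y).zero = 0 := rfl
@[simp] theorem ofNeg_snd (y : Vm) : (ofNeg P y).neg = y := rfl

@[simp] theorem TKK.pos_sub (a b : TKK P) : (a - b).pos = a.pos - b.pos := by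
  simp [sub_eq_add_neg]

@[simp] theorem TKK.zero_sub (a b : TKK P) : (a - b).zero = a.zero - b.zero := by
  simp [sub_eq_add_neg]

@[simp] theorem TKK.neg_sub (a b : TKK P) : (a - b).neg = a.neg - b.neg := by
  simp [sub_eq_add_neg]

theorem eulerOp_lie (a : TKK P) : ⁅eulerOp P, a⁆ = ⟨a.pos, 0, -a.neg⟩ := by
  ext1
  · simp
  · apply TKK.der_ext <;> intro v <;> simp
  · simp

theorem lie_eulerOp (a : TKK P) : ⁅a, eulerOp P⁆ = ⟨-a.pos, 0, a.neg⟩ := by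
  rw [← lie_skew, eulerOp_lie]
  ext1 <;> simp

theorem ofPos_lie_ofPos (x x' : Vp) : ⁅ofPos P x, ofPos P x'⁆ = 0 := by
  ext1
  · simp
  · apply TKK.der_ext <;> intro v <;> simp
  · simp

theorem ofNeg_lie_ofNeg (y y' : Vm) : ⁅ofNeg P y, ofNeg P y'⁆ = 0 := by
  ext1
  · simp
  · apply TKK.der_ext <;> intro v <;> simp
  · simp

variable [Invertible (2 : K)]

/-- Expanding `(ad x)³ [a, b] = 0` by the Leibniz rule and dividing by 3 gives `h4`; one more `ad x`
and a division by 2 give `h5`. These are the terms of degree 3 and 4 of the right-hand side, and the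
terms of degree at most 2 agree by Leibniz. -/
theorem TKK.expAd_lie [Invertible (3 : K)] (x : TKK P) (hx : ∀ a : TKK P, ⁅x, ⁅x, ⁅x, a⁆⁆⁆ = 0)
    (a b : TKK P) : expAd x hx ⁅a, b⁆ = ⁅expAd x hx a, expAd x hx b⁆ := by
  change ⁅a, b⁆ + ⁅x, ⁅a, b⁆⁆ + (⅟2 : K) • ⁅x, ⁅x, ⁅a, b⁆⁆⁆ =
    ⁅a + ⁅x, a⁆ + (⅟2 : K) • ⁅x, ⁅x, a⁆⁆, b + ⁅x, b⁆ + (⅟2 : K) • ⁅x, ⁅x, b⁆⁆⁆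
  have h2 : (⅟2 : K) * 2 = 1 := invOf_mul_self _
  have e1 := leibniz_lie x a b
  have e2 := leibniz_lie x ⁅x, a⁆ b
  have e3 := leibniz_lie x a ⁅x, b⁆
  have e4 := leibniz_lie x ⁅x, a⁆ ⁅x, b⁆
  have e5 := leibniz_lie x ⁅x, ⁅x, a⁆⁆ b
  have e6 := leibniz_lie x a ⁅x, ⁅x, b⁆⁆
  have e7 := leibniz_lie x ⁅x, ⁅x, a⁆⁆ ⁅x, b⁆
  have e8 := leibniz_lie x ⁅x, a⁆ ⁅x, ⁅x, b⁆⁆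
  rw [hx, _root_.zero_lie, _root_.zero_add] at e5 e7
  rw [hx, lie_zero, _root_.add_zero] at e6 e8
  have h3 := hx ⁅a, b⁆
  simp only [e1, lie_add, e2, e3, e4, e5, e6] at h3
  have h4 : ⁅⁅x, ⁅x, a⁆⁆, ⁅x, b⁆⁆ + ⁅⁅x, a⁆, ⁅x, ⁅x, b⁆⁆⁆ = 0 := by
    apply smul_three_cancel (R := K)
    rw [smul_zero, ← h3]
    module
  have h5 : ⁅⁅x, ⁅x, a⁆⁆, ⁅x, ⁅x, b⁆⁆⁆ = 0 := by
    apply smul_two_cancel (R := K)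
    have := congrArg (fun t => ⁅x, t⁆) h4
    simp only [lie_add, e7, e8, lie_zero] at this
    rw [smul_zero, ← this]
    module
  simp only [e1, lie_add, e2, e3, add_lie, lie_smul, smul_lie, h5]
  linear_combination (norm := module) (-(⅟2 : K)) • h4 + h2 • ⁅⁅x, a⁆, ⁅x, b⁆⁆

theorem PE.map_lie [Invertible (3 : K)] (g : P.PE) (a b : TKK P) :
    (g : TKK P ≃ₗ[K] TKK P) ⁅a, b⁆ =
      ⁅(g : TKK P ≃ₗ[K] TKK P) a, (g : TKK P ≃ₗ[K] TKK P) b⁆ := by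
  obtain ⟨g, hg⟩ := g
  change g ⁅a, b⁆ = ⁅g a, g b⁆
  induction hg using Subgroup.closure_induction generalizing a b with
  | mem g hg =>
    rcases hg with ⟨x, rfl⟩ | ⟨y, rfl⟩
    · exact TKK.expAd_lie _ _ a b
    · exact TKK.expAd_lie _ _ a b
  | one => rfl
  | mul g h _ _ hg hh => simp only [LinearEquiv.mul_apply, hg, hh]
  | inv g _ hg =>
    apply g.injective
    rw [hg]
    change g (g.symm _) = ⁅g (g.symm _), g (g.symm _)⁆
    simp

theorem expPos_apply (x : Vp) (a : TKK P) : P.expPos x a =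
    a + ⁅ofPos P x, a⁆ + (⅟2 : K) • ⁅ofPos P x, ⁅ofPos P x, a⁆⁆ := rfl

theorem expNeg_apply (y : Vm) (a : TKK P) : P.expNeg y a =
    a + ⁅ofNeg P y, a⁆ + (⅟2 : K) • ⁅ofNeg P y, ⁅ofNeg P y, a⁆⁆ := rfl

theorem expPos_eulerOp_add (x v : Vp) :
    P.expPos x (eulerOp P + ofPos P v) = eulerOp P + ofPos P (v - x) := by
  have h : ⁅ofPos P x, eulerOp P⁆ = ofPos P (-x) := by
    rw [lie_eulerOp]; ext1 <;> simp
  rw [expPos_apply, lie_add, ofPos_lie_ofPos, h, _root_.add_zero, ofPos_lie_ofPos]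
  ext1 <;> simp [sub_eq_add_neg]

theorem expNeg_eulerOp_add (y v : Vm) :
    P.expNeg y (eulerOp P + ofNeg P v) = eulerOp P + ofNeg P (v + y) := by
  have h : ⁅ofNeg P y, eulerOp P⁆ = ofNeg P y := by
    rw [lie_eulerOp]; ext1 <;> simp
  rw [expNeg_apply, lie_add, ofNeg_lie_ofNeg, h, _root_.add_zero, ofNeg_lie_ofNeg]
  ext1 <;> simp

theorem expPos_eulerOp (x : Vp) : P.expPos x (eulerOp P) = eulerOp P + ofPos P (-x) := by
  have := expPos_eulerOp_add (P := P) x 0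
  have h0 : ofPos P (0 : Vp) = 0 := rfl
  simpa [h0] using this

theorem expNeg_eulerOp (y : Vm) : P.expNeg y (eulerOp P) = eulerOp P + ofNeg P y := by
  have := expNeg_eulerOp_add (P := P) y 0
  have h0 : ofNeg P (0 : Vm) = 0 := rfl
  simpa [h0] using this

/-- The homogeneous components are eigenspaces of `ad E`, so any automorphism that fixes or negates
`E` permutes them. -/
theorem TKK.mem_gradePos_iff_lie (a : TKK P) : a ∈ gradePos P ↔ ⁅eulerOp P, a⁆ = a := by
  rw [eulerOp_lie, TKK.mem_gradePos]
  constructor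
  · rintro ⟨h1, h2⟩
    ext1 <;> simp [h1, h2]
  · intro h
    have h1 := congrArg TKK.zero h
    have h2 := congrArg TKK.neg h
    refine ⟨h1.symm, smul_two_cancel (R := K) ?_⟩
    change -a.neg = a.neg at h2
    rw [two_smul, smul_zero]
    nth_rewrite 1 [← h2]
    abel

theorem TKK.mem_gradeNeg_iff_lie (a : TKK P) : a ∈ gradeNeg P ↔ ⁅eulerOp P, a⁆ = -a := by
  rw [eulerOp_lie, TKK.mem_gradeNeg]
  constructor
  · rintro ⟨h1, h2⟩
    ext1 <;> simp [h1, h2]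
  · intro h
    have h1 := congrArg TKK.zero h
    have h2 := congrArg TKK.pos h
    refine ⟨smul_two_cancel (R := K) ?_, by simpa using h1.symm⟩
    change a.pos = -a.pos at h2
    rw [two_smul, smul_zero]
    nth_rewrite 1 [h2]
    abel

omit [Invertible (2 : K)] in
theorem TKK.mem_gradeZero_iff_lie (a : TKK P) : a ∈ gradeZero P ↔ ⁅eulerOp P, a⁆ = 0 := by
  rw [eulerOp_lie, TKK.mem_gradeZero, TKK.ext_iff]
  simp

/-- The Euler operator is fixed by all automorphisms of the 3-grading. -/
theorem gradedAut_eulerOp {h : TKK P ≃ₗ[K] TKK P} (hh : h ∈ P.gradedAut) :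
    h (eulerOp P) = eulerOp P := by
  obtain ⟨h0, h1, h2, h3⟩ := hh
  have hz : h (eulerOp P) ∈ gradeZero P := by
    rw [← h2]
    exact ⟨eulerOp P, by simp, rfl⟩
  ext1
  · exact hz.1
  -- Degree zero acts faithfully on `V^±`, and every element of `V^±` is an image under `h` of an
  -- eigenvector of `ad E`; hence `h E` acts on `V^±` as `E` does.
  · apply TKK.der_ext <;> intro v
    · have : ofPos P v ∈ (gradePos P).map (h : TKK P →ₗ[K] TKK P) := by rw [h1]; simp
      obtain ⟨u, hu, e⟩ := this
      change h u = _ at e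
      have := h0 (eulerOp P) u
      rw [(TKK.mem_gradePos_iff_lie u).1 hu, e] at this
      simpa using (congrArg TKK.pos this).symm
    · have : ofNeg P v ∈ (gradeNeg P).map (h : TKK P →ₗ[K] TKK P) := by rw [h3]; simp
      obtain ⟨u, hu, e⟩ := this
      change h u = _ at e
      have := h0 (eulerOp P) u
      rw [(TKK.mem_gradeNeg_iff_lie u).1 hu, map_neg, e] at this
      simpa using (congrArg TKK.neg this).symm
  · exact hz.2

variable [Invertible (3 : K)]

/-- The structure group is the stabilizer of the Euler operator. -/
theorem mem_structureGroup_iff (g : P.PE) :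
    g ∈ P.structureGroup ↔ (g : TKK P ≃ₗ[K] TKK P) (eulerOp P) = eulerOp P := by
  refine ⟨fun h => gradedAut_eulerOp h, fun h => ?_⟩
  -- An automorphism fixing `E` commutes with `ad E` and so preserves its eigenspaces.
  have key : ∀ (c : TKK P), ⁅eulerOp P, (g : TKK P ≃ₗ[K] TKK P) c⁆ =
      (g : TKK P ≃ₗ[K] TKK P) ⁅eulerOp P, c⁆ := by
    intro c
    rw [PE.map_lie, h]
  have hs : ∀ S : Submodule K (TKK P),
      (∀ c, (g : TKK P ≃ₗ[K] TKK P) c ∈ S ↔ c ∈ S) →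
      S.map ((g : TKK P ≃ₗ[K] TKK P) : TKK P →ₗ[K] TKK P) = S := by
    intro S hS
    ext c
    constructor
    · rintro ⟨d, hd, rfl⟩
      exact (hS d).2 hd
    · intro hc
      obtain ⟨d, rfl⟩ := (g : TKK P ≃ₗ[K] TKK P).surjective c
      exact ⟨d, (hS d).1 hc, rfl⟩
  refine ⟨PE.map_lie g, hs _ fun c => ?_, hs _ fun c => ?_, hs _ fun c => ?_⟩
  · rw [TKK.mem_gradePos_iff_lie, TKK.mem_gradePos_iff_lie, key, EmbeddingLike.apply_eq_iff_eq]
  · rw [TKK.mem_gradeZero_iff_lie, TKK.mem_gradeZero_iff_lie, key, EmbeddingLike.map_eq_zero_iff]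
  · rw [TKK.mem_gradeNeg_iff_lie, TKK.mem_gradeNeg_iff_lie, key, ← map_neg,
      EmbeddingLike.apply_eq_iff_eq]

/-- `U⁻` acts on `E + V⁻` by all translations and `H` is the stabilizer of `E`. Membership in a
generated subgroup thus becomes a single equation in the Lie algebra. -/
theorem mem_paraNeg_iff (g : P.PE) : g ∈ P.paraNeg ↔
    ∃ y, (g : TKK P ≃ₗ[K] TKK P) (eulerOp P) = eulerOp P + ofNeg P y := by
  constructor
  · intro hg
    -- Mapping `E + V⁻` into itself is visibly closed under products but not under inverses, so `S`
    -- is only a submonoid and the inverses of the generators are treated separately.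
    let S : Submonoid P.PE :=
      { carrier := {k | ∀ y, ∃ y', (k : TKK P ≃ₗ[K] TKK P) (eulerOp P + ofNeg P y) =
          eulerOp P + ofNeg P y'}
        mul_mem' := by
          intro k l hk hl y
          obtain ⟨y1, h1⟩ := hl y
          obtain ⟨y2, h2⟩ := hk y1
          exact ⟨y2, by rw [Subgroup.coe_mul, LinearEquiv.mul_apply, h1, h2]⟩
        one_mem' := fun y => ⟨y, rfl⟩ }
    have hu : ∀ y, P.uNeg y ∈ S := fun y y' => ⟨_, expNeg_eulerOp_add y y'⟩
    have hu' : ∀ y, (P.uNeg y)⁻¹ ∈ S := by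
      intro y y'
      refine ⟨y' - y, ?_⟩
      change (P.expNeg y).symm _ = _
      rw [LinearEquiv.symm_apply_eq, expNeg_eulerOp_add, sub_add_cancel]
    have hH : P.structureGroup.toSubmonoid ≤ S := by
      intro k hk y
      have h1 := gradedAut_eulerOp hk
      have h2 : (k : TKK P ≃ₗ[K] TKK P) (ofNeg P y) ∈ gradeNeg P := by
        rw [← hk.2.2.2]
        exact ⟨ofNeg P y, by simp, rfl⟩
      refine ⟨((k : TKK P ≃ₗ[K] TKK P) (ofNeg P y)).neg, ?_⟩
      change (k : TKK P ≃ₗ[K] TKK P) (eulerOp P) = _ at h1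
      rw [map_add, h1]
      congr 1
      ext1
      · exact h2.1
      · exact h2.2
      · rfl
    have hS : P.paraNeg.toSubmonoid ≤ S := by
      have : P.paraNeg = Subgroup.closure (Set.range P.uNeg ∪ P.structureGroup) := by
        rw [Subgroup.closure_union, Subgroup.closure_eq, paraNeg]
      rw [this]
      intro k hk
      refine Subgroup.closure_induction'' (p := fun k _ => k ∈ S) ?_ ?_ ?_ ?_ hk
      · rintro _ (⟨y, rfl⟩ | h)
        exacts [hu y, hH h]
      · rintro _ (⟨y, rfl⟩ | h)
        exacts [hu' y, hH (P.structureGroup.inv_mem h)]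
      · exact S.one_mem
      · intro _ _ _ _ h1 h2
        exact S.mul_mem h1 h2
    have h0 : ofNeg P (0 : Vm) = 0 := rfl
    simpa [h0] using hS hg 0
  · rintro ⟨y, hy⟩
    have h1 : (P.uNeg y)⁻¹ * g ∈ P.structureGroup := by
      rw [mem_structureGroup_iff]
      change (P.expNeg y).symm ((g : TKK P ≃ₗ[K] TKK P) (eulerOp P)) = _
      rw [LinearEquiv.symm_apply_eq, hy, expNeg_eulerOp]
    have h2 : g = P.uNeg y * ((P.uNeg y)⁻¹ * g) := by group
    rw [h2]
    exact mul_mem (Subgroup.mem_sup_left (Subgroup.subset_closure ⟨y, rfl⟩))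
      (Subgroup.mem_sup_right h1)

theorem mem_paraPos_iff (g : P.PE) : g ∈ P.paraPos ↔
    ∃ x, (g : TKK P ≃ₗ[K] TKK P) (eulerOp P) = eulerOp P + ofPos P x := by
  constructor
  · intro hg
    let S : Submonoid P.PE :=
      { carrier := {k | ∀ y, ∃ y', (k : TKK P ≃ₗ[K] TKK P) (eulerOp P + ofPos P y) =
          eulerOp P + ofPos P y'}
        mul_mem' := by
          intro k l hk hl y
          obtain ⟨y1, h1⟩ := hl y
          obtain ⟨y2, h2⟩ := hk y1
          exact ⟨y2, by rw [Subgroup.coe_mul, LinearEquiv.mul_apply, h1, h2]⟩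
        one_mem' := fun y => ⟨y, rfl⟩ }
    have hu : ∀ y, P.uPos y ∈ S := fun y y' => ⟨_, expPos_eulerOp_add y y'⟩
    have hu' : ∀ y, (P.uPos y)⁻¹ ∈ S := by
      intro y y'
      refine ⟨y' + y, ?_⟩
      change (P.expPos y).symm _ = _
      rw [LinearEquiv.symm_apply_eq, expPos_eulerOp_add, add_sub_cancel_right]
    have hH : P.structureGroup.toSubmonoid ≤ S := by
      intro k hk y
      have h1 := gradedAut_eulerOp hk
      have h2 : (k : TKK P ≃ₗ[K] TKK P) (ofPos P y) ∈ gradePos P := by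
        rw [← hk.2.1]
        exact ⟨ofPos P y, by simp, rfl⟩
      refine ⟨((k : TKK P ≃ₗ[K] TKK P) (ofPos P y)).pos, ?_⟩
      change (k : TKK P ≃ₗ[K] TKK P) (eulerOp P) = _ at h1
      rw [map_add, h1]
      congr 1
      ext1
      · rfl
      · exact h2.1
      · exact h2.2
    have hS : P.paraPos.toSubmonoid ≤ S := by
      have : P.paraPos = Subgroup.closure (Set.range P.uPos ∪ P.structureGroup) := by
        rw [Subgroup.closure_union, Subgroup.closure_eq, paraPos]
      rw [this]
      intro k hk
      refine Subgroup.closure_induction'' (p := fun k _ => k ∈ S) ?_ ?_ ?_ ?_ hk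
      · rintro _ (⟨y, rfl⟩ | h)
        exacts [hu y, hH h]
      · rintro _ (⟨y, rfl⟩ | h)
        exacts [hu' y, hH (P.structureGroup.inv_mem h)]
      · exact S.one_mem
      · intro _ _ _ _ h1 h2
        exact S.mul_mem h1 h2
    have h0 : ofPos P (0 : Vp) = 0 := rfl
    simpa [h0] using hS hg 0
  · rintro ⟨x, hx⟩
    have h1 : (P.uPos (-x))⁻¹ * g ∈ P.structureGroup := by
      rw [mem_structureGroup_iff]
      change (P.expPos (-x)).symm ((g : TKK P ≃ₗ[K] TKK P) (eulerOp P)) = _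
      rw [LinearEquiv.symm_apply_eq, hx, expPos_eulerOp, _root_.neg_neg]
    have h2 : g = P.uPos (-x) * ((P.uPos (-x))⁻¹ * g) := by group
    rw [h2]
    exact mul_mem (Subgroup.mem_sup_left (Subgroup.subset_closure ⟨_, rfl⟩))
      (Subgroup.mem_sup_right h1)

end LieAutomorphisms

/-! ### Euler operators of transversal pairs as affine coordinates -/

section EulerOperators

variable {K Vp Vm : Type*} [CommRing K] [AddCommGroup Vp] [AddCommGroup Vm]
  [Module K Vp] [Module K Vm] {P : LinearJordanPair K Vp Vm} [Invertible (2 : K)]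

open TKK (ofPos ofNeg)

theorem smul_op_eq_iff (g h : P.PE) : g • P.op = h • P.op ↔ g⁻¹ * h ∈ P.paraNeg := by
  change ((g * 1 : P.PE) : P.PE ⧸ P.paraNeg) = ((h * 1 : P.PE) : P.PE ⧸ P.paraNeg) ↔ _
  rw [mul_one, mul_one, QuotientGroup.eq]

theorem smul_om_eq_iff (g h : P.PE) : g • P.om = h • P.om ↔ g⁻¹ * h ∈ P.paraPos := by
  change ((g * 1 : P.PE) : P.PE ⧸ P.paraPos) = ((h * 1 : P.PE) : P.PE ⧸ P.paraPos) ↔ _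
  rw [mul_one, mul_one, QuotientGroup.eq]

theorem exists_smul_op (x : P.Xp) : ∃ g : P.PE, g • P.op = x := by
  obtain ⟨g, rfl⟩ := QuotientGroup.mk_surjective x
  exact ⟨g, congrArg _ (mul_one g)⟩

theorem PE.inv_mul_apply (g h : P.PE) (z : TKK P) : ((g⁻¹ * h : P.PE) : TKK P ≃ₗ[K] TKK P) z =
    (g : TKK P ≃ₗ[K] TKK P).symm ((h : TKK P ≃ₗ[K] TKK P) z) := rfl

theorem PE.mul_apply (g h : P.PE) (z : TKK P) : ((g * h : P.PE) : TKK P ≃ₗ[K] TKK P) z =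
    (g : TKK P ≃ₗ[K] TKK P) ((h : TKK P ≃ₗ[K] TKK P) z) := rfl

theorem coe_uPos (x : Vp) : (P.uPos x : TKK P ≃ₗ[K] TKK P) = P.expPos x := rfl
theorem coe_uNeg (y : Vm) : (P.uNeg y : TKK P ≃ₗ[K] TKK P) = P.expNeg y := rfl

theorem uNeg_smul_op (y : Vm) : P.uNeg y • P.op = P.op := by
  have := (smul_op_eq_iff (P.uNeg y) 1).2 (by
    rw [mul_one]
    exact inv_mem (Subgroup.mem_sup_left (Subgroup.subset_closure ⟨y, rfl⟩)))
  rwa [one_smul] at this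

theorem uPos_smul_om (x : Vp) : P.uPos x • P.om = P.om := by
  have := (smul_om_eq_iff (P.uPos x) 1).2 (by
    rw [mul_one]
    exact inv_mem (Subgroup.mem_sup_left (Subgroup.subset_closure ⟨x, rfl⟩)))
  rwa [one_smul] at this

theorem transversal_smul (g : P.PE) : P.Transversal (g • P.op) (g • P.om) := ⟨g, rfl, rfl⟩

theorem Transversal.smul {x : P.Xp} {a : P.Xm} (h : P.Transversal x a) (g : P.PE) :
    P.Transversal (g • x) (g • a) := by
  obtain ⟨k, rfl, rfl⟩ := h
  exact ⟨g * k, mul_smul _ _ _, mul_smul _ _ _⟩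

theorem transversal_chartNeg (g : P.PE) (w : Vm) :
    P.Transversal (g • P.op) (P.chartNeg g w) :=
  ⟨g * P.uNeg w, by rw [mul_smul, uNeg_smul_op], mul_smul _ _ _⟩

theorem transversal_chartPos (g : P.PE) (v : Vp) :
    P.Transversal (P.chartPos g v) (g • P.om) :=
  ⟨g * P.uPos v, mul_smul _ _ _, by rw [mul_smul, uPos_smul_om]⟩

open Classical in
/-- The Euler operator of a transversal pair: `euler (g o⁺) (g o⁻) = g E`. -/
noncomputable def euler (x : P.Xp) (a : P.Xm) : TKK P :=
  if h : P.Transversal x a then (h.choose : TKK P ≃ₗ[K] TKK P) (eulerOp P) else 0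

variable [Invertible (3 : K)]

theorem exists_of_smul_op_eq {g h : P.PE} (e : g • P.op = h • P.op) :
    ∃ y, (h : TKK P ≃ₗ[K] TKK P) (eulerOp P) =
      (g : TKK P ≃ₗ[K] TKK P) (eulerOp P + ofNeg P y) := by
  rw [smul_op_eq_iff, mem_paraNeg_iff] at e
  obtain ⟨y, hy⟩ := e
  rw [PE.inv_mul_apply, LinearEquiv.symm_apply_eq] at hy
  exact ⟨y, hy⟩

theorem exists_of_smul_om_eq {g h : P.PE} (e : g • P.om = h • P.om) :
    ∃ x, (h : TKK P ≃ₗ[K] TKK P) (eulerOp P) =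
      (g : TKK P ≃ₗ[K] TKK P) (eulerOp P + ofPos P x) := by
  rw [smul_om_eq_iff, mem_paraPos_iff] at e
  obtain ⟨y, hy⟩ := e
  rw [PE.inv_mul_apply, LinearEquiv.symm_apply_eq] at hy
  exact ⟨y, hy⟩

theorem smul_op_eq_of_eulerOp_eq {g h : P.PE} {y : Vm}
    (e : (h : TKK P ≃ₗ[K] TKK P) (eulerOp P) =
      (g : TKK P ≃ₗ[K] TKK P) (eulerOp P + ofNeg P y)) : g • P.op = h • P.op := by
  rw [smul_op_eq_iff, mem_paraNeg_iff]
  exact ⟨y, by rw [PE.inv_mul_apply, LinearEquiv.symm_apply_eq, e]⟩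

theorem smul_om_eq_of_eulerOp_eq {g h : P.PE} {x : Vp}
    (e : (h : TKK P ≃ₗ[K] TKK P) (eulerOp P) =
      (g : TKK P ≃ₗ[K] TKK P) (eulerOp P + ofPos P x)) : g • P.om = h • P.om := by
  rw [smul_om_eq_iff, mem_paraPos_iff]
  exact ⟨x, by rw [PE.inv_mul_apply, LinearEquiv.symm_apply_eq, e]⟩

/-- Independence of the chosen group element: two choices differ on `E` both by an element of `g V⁻`
and by one of `g V⁺`, and these meet in zero. -/
theorem euler_smul (g : P.PE) :
    euler (g • P.op) (g • P.om) = (g : TKK P ≃ₗ[K] TKK P) (eulerOp P) := by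
  have h := transversal_smul g
  rw [euler, dif_pos h]
  obtain ⟨y, hy⟩ := exists_of_smul_op_eq h.choose_spec.1.symm
  obtain ⟨x, hx⟩ := exists_of_smul_om_eq h.choose_spec.2.symm
  rw [hy, EmbeddingLike.apply_eq_iff_eq] at hx
  have : y = 0 := by simpa using congrArg TKK.neg hx
  subst this
  rw [hy]
  congr 1
  exact _root_.add_zero _

theorem Transversal.exists_smul {x : P.Xp} {a : P.Xm} (h : P.Transversal x a) :
    ∃ g : P.PE, g • P.op = x ∧ g • P.om = a ∧
      (g : TKK P ≃ₗ[K] TKK P) (eulerOp P) = euler x a := by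
  obtain ⟨g, rfl, rfl⟩ := h
  exact ⟨g, rfl, rfl, (euler_smul g).symm⟩

/-- The principle behind all later equalities of points: they are checked on Euler operators inside
the Lie algebra. -/
theorem Transversal.ext {x x' : P.Xp} {a a' : P.Xm} (h : P.Transversal x a)
    (h' : P.Transversal x' a') (e : euler x a = euler x' a') : x = x' ∧ a = a' := by
  obtain ⟨g, rfl, rfl, hg⟩ := h.exists_smul
  obtain ⟨g', rfl, rfl, hg'⟩ := h'.exists_smul
  rw [← hg, ← hg'] at e
  have h0 : ofNeg P (0 : Vm) = 0 := rfl
  have h0' : ofPos P (0 : Vp) = 0 := rfl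
  refine ⟨smul_op_eq_of_eulerOp_eq (y := 0) ?_, smul_om_eq_of_eulerOp_eq (x := 0) ?_⟩
  · rw [h0, _root_.add_zero, e]
  · rw [h0', _root_.add_zero, e]

theorem euler_smul_smul (g : P.PE) {x : P.Xp} {a : P.Xm} (h : P.Transversal x a) :
    euler (g • x) (g • a) = (g : TKK P ≃ₗ[K] TKK P) (euler x a) := by
  obtain ⟨k, rfl, rfl, hk⟩ := h.exists_smul
  rw [← hk, ← mul_smul, ← mul_smul, euler_smul, PE.mul_apply]

theorem euler_chartNeg (g : P.PE) (w : Vm) : euler (g • P.op) (P.chartNeg g w) =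
    (g : TKK P ≃ₗ[K] TKK P) (eulerOp P + ofNeg P w) := by
  have := euler_smul (g * P.uNeg w)
  rwa [mul_smul, mul_smul, uNeg_smul_op, PE.mul_apply, coe_uNeg, expNeg_eulerOp] at this

theorem euler_chartPos (g : P.PE) (v : Vp) : euler (P.chartPos g v) (g • P.om) =
    (g : TKK P ≃ₗ[K] TKK P) (eulerOp P - ofPos P v) := by
  have := euler_smul (g * P.uPos v)
  rwa [mul_smul, mul_smul, uPos_smul_om, PE.mul_apply, coe_uPos, expPos_eulerOp, TKK.ofPos_neg,
    ← sub_eq_add_neg] at this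

/-- Two pairs with the same first entry have Euler operators differing by an element of `g V⁻`,
which is the coordinate wanted. -/
theorem Transversal.exists_chartNeg {g : P.PE} {b : P.Xm} (h : P.Transversal (g • P.op) b) :
    ∃ w, P.chartNeg g w = b := by
  obtain ⟨k, hk, rfl, hk'⟩ := h.exists_smul
  obtain ⟨y, hy⟩ := exists_of_smul_op_eq hk.symm
  exact ⟨y, (Transversal.ext (transversal_chartNeg g y) h
    (by rw [euler_chartNeg, ← hk', hy])).2⟩

theorem Transversal.exists_chartPos {g : P.PE} {y : P.Xp} (h : P.Transversal y (g • P.om)) :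
    ∃ v, P.chartPos g v = y := by
  obtain ⟨k, rfl, hk, hk'⟩ := h.exists_smul
  obtain ⟨x, hx⟩ := exists_of_smul_om_eq hk.symm
  refine ⟨-x, (Transversal.ext (transversal_chartPos g (-x)) h ?_).1⟩
  rw [euler_chartPos, ← hk', hx, TKK.ofPos_neg, sub_neg_eq_add]

/-- The formula does not mention the chart, so it holds for whichever chart the choice in the
definition picks, and it determines the value by `Transversal.ext`. -/
theorem piNeg_spec (r : K) {a b : P.Xm} {x : P.Xp} (ha : P.Transversal x a)
    (hb : P.Transversal x b) : P.Transversal x (P.piNeg r a x b) ∧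
      euler x (P.piNeg r a x b) = (1 - r) • euler x a + r • euler x b := by
  obtain ⟨g, rfl, rfl, -⟩ := ha.exists_smul
  obtain ⟨w, rfl⟩ := hb.exists_chartNeg
  have h : ∃ c, ∃ (k : P.PE) (w' : Vm), k • P.om = g • P.om ∧ k • P.op = g • P.op ∧
    P.chartNeg k w' = P.chartNeg g w ∧ P.chartNeg k (r • w') = c := ⟨_, g, w, rfl, rfl, rfl, rfl⟩
  rw [piNeg, dif_pos h]
  obtain ⟨k, w', h1, h2, h3, h4⟩ := h.choose_spec
  rw [← h4, ← h3, ← h1, ← h2, euler_chartNeg, euler_chartNeg, euler_smul]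
  refine ⟨transversal_chartNeg _ _, ?_⟩
  have : ofNeg P (r • w') = r • ofNeg P w' := by ext1 <;> simp
  rw [this]
  simp only [map_add, map_smul]
  module

theorem piPos_spec (r : K) {x y : P.Xp} {a : P.Xm} (hx : P.Transversal x a)
    (hy : P.Transversal y a) : P.Transversal (P.piPos r x a y) a ∧
      euler (P.piPos r x a y) a = (1 - r) • euler x a + r • euler y a := by
  obtain ⟨g, rfl, rfl, -⟩ := hx.exists_smul
  obtain ⟨v, rfl⟩ := hy.exists_chartPos
  have h : ∃ z, ∃ (k : P.PE) (v' : Vp), k • P.op = g • P.op ∧ k • P.om = g • P.om ∧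
    P.chartPos k v' = P.chartPos g v ∧ P.chartPos k (r • v') = z := ⟨_, g, v, rfl, rfl, rfl, rfl⟩
  rw [piPos, dif_pos h]
  obtain ⟨k, v', h1, h2, h3, h4⟩ := h.choose_spec
  rw [← h4, ← h3, ← h1, ← h2, euler_chartPos, euler_chartPos, euler_smul]
  refine ⟨transversal_chartPos _ _, ?_⟩
  have : ofPos P (r • v') = r • ofPos P v' := by ext1 <;> simp
  rw [this]
  simp only [map_sub, map_smul]
  module

theorem sigmaNeg_spec {a b c : P.Xm} {x : P.Xp} (ha : P.Transversal x a)
    (hb : P.Transversal x b) (hc : P.Transversal x c) :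
    P.Transversal x (P.sigmaNeg a x b c) ∧
      euler x (P.sigmaNeg a x b c) = euler x b + euler x c - euler x a := by
  obtain ⟨g, rfl, rfl, -⟩ := ha.exists_smul
  obtain ⟨w, rfl⟩ := hb.exists_chartNeg
  obtain ⟨w₂, rfl⟩ := hc.exists_chartNeg
  have h : ∃ t, ∃ (k : P.PE) (v v₂ : Vm), k • P.om = g • P.om ∧ k • P.op = g • P.op ∧
    P.chartNeg k v = P.chartNeg g w ∧ P.chartNeg k v₂ = P.chartNeg g w₂ ∧
    P.chartNeg k (v + v₂) = t := ⟨_, g, w, w₂, rfl, rfl, rfl, rfl, rfl⟩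
  rw [sigmaNeg, dif_pos h]
  obtain ⟨k, v, v₂, h1, h2, h3, h4, h5⟩ := h.choose_spec
  rw [← h5, ← h4, ← h3, ← h1, ← h2, euler_chartNeg, euler_chartNeg, euler_chartNeg, euler_smul]
  refine ⟨transversal_chartNeg _ _, ?_⟩
  have : ofNeg P (v + v₂) = ofNeg P v + ofNeg P v₂ := by ext1 <;> simp
  rw [this]
  simp only [map_add]
  abel

theorem sigmaPos_spec {x y z : P.Xp} {a : P.Xm} (hx : P.Transversal x a)
    (hy : P.Transversal y a) (hz : P.Transversal z a) :
    P.Transversal (P.sigmaPos x a y z) a ∧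
      euler (P.sigmaPos x a y z) a = euler y a + euler z a - euler x a := by
  obtain ⟨g, rfl, rfl, -⟩ := hx.exists_smul
  obtain ⟨w, rfl⟩ := hy.exists_chartPos
  obtain ⟨w₂, rfl⟩ := hz.exists_chartPos
  have h : ∃ t, ∃ (k : P.PE) (v v₂ : Vp), k • P.op = g • P.op ∧ k • P.om = g • P.om ∧
    P.chartPos k v = P.chartPos g w ∧ P.chartPos k v₂ = P.chartPos g w₂ ∧
    P.chartPos k (v + v₂) = t := ⟨_, g, w, w₂, rfl, rfl, rfl, rfl, rfl⟩
  rw [sigmaPos, dif_pos h]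
  obtain ⟨k, v, v₂, h1, h2, h3, h4, h5⟩ := h.choose_spec
  rw [← h5, ← h4, ← h3, ← h1, ← h2, euler_chartPos, euler_chartPos, euler_chartPos, euler_smul]
  refine ⟨transversal_chartPos _ _, ?_⟩
  have : ofPos P (v + v₂) = ofPos P v + ofPos P v₂ := by ext1 <;> simp
  rw [this]
  simp only [map_add, map_sub]
  abel

theorem midpointMap_spec {a b : P.Xm} {x : P.Xp} (ha : P.Transversal x a)
    (hb : P.Transversal x b) : P.Transversal x (P.midpointMap a b x) ∧
      euler x (P.midpointMap a b x) = (⅟2 : K) • (euler x a + euler x b) := by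
  obtain ⟨h1, h2⟩ := piNeg_spec (⅟2 : K) ha hb
  refine ⟨h1, h2.trans ?_⟩
  have : 1 - (⅟2 : K) = ⅟2 := by
    linear_combination -(invOf_mul_self (2 : K))
  rw [this, smul_add]

end EulerOperators

/-! ### Reflections in Euler operators and the dilations `(-1)_{x,a}` -/

section Reflections

variable {K Vp Vm : Type*} [CommRing K] [AddCommGroup Vp] [AddCommGroup Vm]
  [Module K Vp] [Module K Vm] {P : LinearJordanPair K Vp Vm}

open TKK (ofPos ofNeg)

/-- The linear map `1 - 2 (ad e)²`; for an Euler operator `e` it is the automorphism which is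
`-1` on the odd part of the 3-grading and `1` on the even part. -/
def reflection (e : TKK P) : TKK P →ₗ[K] TKK P :=
  LinearMap.id - (2 : K) • (LieAlgebra.ad K (TKK P) e ∘ₗ LieAlgebra.ad K (TKK P) e)

theorem reflection_apply (e z : TKK P) : reflection e z = z - (2 : K) • ⁅e, ⁅e, z⁆⁆ := rfl

theorem reflection_self (e : TKK P) : reflection e e = e := by
  simp [reflection_apply]

theorem gradeScale_neg_one (z : TKK P) : P.gradeScale (-1) z = ⟨-z.pos, z.zero, -z.neg⟩ := by
  ext1 <;> simp [gradeScale, inv_neg]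

theorem reflection_eulerOp (z : TKK P) : reflection (eulerOp P) z = P.gradeScale (-1) z := by
  rw [reflection_apply, gradeScale_neg_one, eulerOp_lie, eulerOp_lie]
  ext1
  · simp [two_smul]
  · simp
  · simp [two_smul]

variable [Invertible (2 : K)] [Invertible (3 : K)]

/-- Equivariance reduces statements about reflections in Euler operators to `E` itself, whose
reflection is the sign change on `V^±`. -/
theorem reflection_map (g : P.PE) (e z : TKK P) :
    reflection ((g : TKK P ≃ₗ[K] TKK P) e) ((g : TKK P ≃ₗ[K] TKK P) z) =
      (g : TKK P ≃ₗ[K] TKK P) (reflection e z) := by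
  simp only [reflection_apply, map_sub, map_smul, PE.map_lie]

theorem Transversal.reflection_lie {x : P.Xp} {a : P.Xm} (h : P.Transversal x a) (z z' : TKK P) :
    reflection (euler x a) ⁅z, z'⁆ = ⁅reflection (euler x a) z, reflection (euler x a) z'⁆ := by
  obtain ⟨g, rfl, rfl, e⟩ := h.exists_smul
  obtain ⟨z, rfl⟩ := (g : TKK P ≃ₗ[K] TKK P).surjective z
  obtain ⟨z', rfl⟩ := (g : TKK P ≃ₗ[K] TKK P).surjective z'
  rw [← e, ← PE.map_lie, reflection_map, reflection_map, reflection_map, ← PE.map_lie,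
    reflection_eulerOp, reflection_eulerOp, reflection_eulerOp, (P.gradeScale_mem _).1]

theorem Transversal.reflection_reflection {x : P.Xp} {a : P.Xm} (h : P.Transversal x a)
    (z : TKK P) : reflection (euler x a) (reflection (euler x a) z) = z := by
  obtain ⟨g, rfl, rfl, e⟩ := h.exists_smul
  obtain ⟨z, rfl⟩ := (g : TKK P ≃ₗ[K] TKK P).surjective z
  rw [← e, reflection_map, reflection_map, reflection_eulerOp, reflection_eulerOp,
    gradeScale_neg_one, gradeScale_neg_one]
  simp

/-- An involutive automorphism carries `ad e` to its conjugate; this is the algebraic source of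
(S3). -/
theorem Transversal.reflection_conj {x : P.Xp} {a : P.Xm} (h : P.Transversal x a)
    (e z : TKK P) : reflection (reflection (euler x a) e) z =
      reflection (euler x a) (reflection e (reflection (euler x a) z)) := by
  rw [reflection_apply e, map_sub, map_smul, h.reflection_lie, h.reflection_lie,
    h.reflection_reflection]
  rfl

/-- On the affine space of Euler operators with fixed `x`, the reflection is the point reflection:
it reverses the component in `g V⁻`. -/
theorem Transversal.reflection_euler_left {x : P.Xp} {a b : P.Xm} (ha : P.Transversal x a)
    (hb : P.Transversal x b) :
    reflection (euler x a) (euler x b) = (2 : K) • euler x a - euler x b := by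
  obtain ⟨g, rfl, rfl, e⟩ := ha.exists_smul
  obtain ⟨w, rfl⟩ := hb.exists_chartNeg
  rw [euler_chartNeg, ← e, reflection_map, ← map_smul, ← map_sub, reflection_eulerOp,
    gradeScale_neg_one]
  congr 1
  ext1 <;> simp [two_smul]

theorem Transversal.reflection_euler_right {x y : P.Xp} {a : P.Xm} (hx : P.Transversal x a)
    (hy : P.Transversal y a) :
    reflection (euler x a) (euler y a) = (2 : K) • euler x a - euler y a := by
  obtain ⟨g, rfl, rfl, e⟩ := hx.exists_smul
  obtain ⟨w, rfl⟩ := hy.exists_chartPos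
  rw [euler_chartPos, ← e, reflection_map, ← map_smul, ← map_sub, reflection_eulerOp,
    gradeScale_neg_one]
  congr 1
  ext1 <;> simp [two_smul]

omit [Invertible (3 : K)] in
theorem paraPos_le_comap_scaleConj (s : Kˣ) :
    P.paraPos ≤ P.paraPos.comap (P.scaleConj s) := by
  refine sup_le ((Subgroup.closure_le _).2 ?_) ?_
  · rintro _ ⟨y, rfl⟩
    change P.scaleConj s (P.uPos y) ∈ P.paraPos
    rw [scaleConj_uPos]
    exact Subgroup.mem_sup_left (Subgroup.subset_closure ⟨_, rfl⟩)
  · intro g hg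
    refine Subgroup.mem_sup_right ?_
    change P.gradeScale s * (g : TKK P ≃ₗ[K] TKK P) * (P.gradeScale s)⁻¹ ∈ P.gradedAut
    exact mul_mem (mul_mem (P.gradeScale_mem s) hg) (inv_mem (P.gradeScale_mem s))

variable (P) in
omit [Invertible (3 : K)] in
/-- The transformation of `X⁻` induced by `(s, id, s⁻¹)`. -/
def baseDilationNeg (s : Kˣ) : P.Xm → P.Xm :=
  Quotient.map' (P.scaleConj s) (by
    intro g h hgh
    rw [QuotientGroup.leftRel_apply] at hgh ⊢
    rw [← map_inv, ← map_mul]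
    exact paraPos_le_comap_scaleConj s hgh)

omit [Invertible (3 : K)] in
theorem baseDilation_smul_op (s : Kˣ) (g : P.PE) :
    P.baseDilation s (g • P.op) = P.scaleConj s g • P.op := by
  change ((P.scaleConj s (g * 1) : P.PE) : P.PE ⧸ P.paraNeg) =
    ((P.scaleConj s g * 1 : P.PE) : P.PE ⧸ P.paraNeg)
  rw [mul_one, mul_one]

omit [Invertible (3 : K)] in
theorem baseDilationNeg_smul_om (s : Kˣ) (g : P.PE) :
    P.baseDilationNeg s (g • P.om) = P.scaleConj s g • P.om := by
  change ((P.scaleConj s (g * 1) : P.PE) : P.PE ⧸ P.paraPos) =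
    ((P.scaleConj s g * 1 : P.PE) : P.PE ⧸ P.paraPos)
  rw [mul_one, mul_one]

theorem Transversal.baseDilation {y : P.Xp} {b : P.Xm} (h : P.Transversal y b) (s : Kˣ) :
    P.Transversal (P.baseDilation s y) (P.baseDilationNeg s b) ∧
      euler (P.baseDilation s y) (P.baseDilationNeg s b) = P.gradeScale s (euler y b) := by
  obtain ⟨g, rfl, rfl, e⟩ := h.exists_smul
  rw [baseDilation_smul_op, baseDilationNeg_smul_om]
  refine ⟨transversal_smul _, ?_⟩
  rw [euler_smul, ← e]
  change P.gradeScale s ((g : TKK P ≃ₗ[K] TKK P) ((P.gradeScale s)⁻¹ (eulerOp P))) = _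
  rw [gradedAut_eulerOp (inv_mem (P.gradeScale_mem s))]

/-- The dilation `(-1)_{x,a}` is induced by the reflection in the Euler operator of `(x, a)`. -/
theorem Transversal.exists_dilation {x : P.Xp} {a : P.Xm} (h : P.Transversal x a) :
    ∃ τ : P.Xm → P.Xm, ∀ y b, P.Transversal y b →
      P.Transversal (P.dilation (-1) x a y) (τ b) ∧
        euler (P.dilation (-1) x a y) (τ b) = reflection (euler x a) (euler y b) := by
  obtain ⟨h1, h2⟩ := h.choose_spec
  -- The partner on `X⁻` is conjugated by the same group element that the definition of `dilation`
  -- picks, so that pairs are transported together.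
  refine ⟨fun b => h.choose • P.baseDilationNeg (-1) (h.choose⁻¹ • b), fun y b hy => ?_⟩
  rw [dilation, dif_pos h]
  obtain ⟨h3, h4⟩ := (hy.smul h.choose⁻¹).baseDilation (-1)
  refine ⟨h3.smul _, ?_⟩
  rw [euler_smul_smul _ h3, h4, euler_smul_smul _ hy]
  have e := euler_smul h.choose
  rw [h1, h2] at e
  rw [e, ← reflection_eulerOp, ← reflection_map]
  congr 1
  exact LinearEquiv.apply_symm_apply _ _

end Reflections

/-! ### The symmetric space `U_{a,b}` -/

section SymmetricSpace

variable {K Vp Vm : Type*} [CommRing K] [AddCommGroup Vp] [AddCommGroup Vm]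
  [Module K Vp] [Module K Vm] {P : LinearJordanPair K Vp Vm}
  [Invertible (2 : K)] [Invertible (3 : K)]

open TKK (ofPos ofNeg)

omit [Invertible (3 : K)] in
theorem exists_transversal (y : P.Xp) : ∃ b, P.Transversal y b := by
  obtain ⟨g, rfl⟩ := exists_smul_op y
  exact ⟨_, transversal_smul g⟩

theorem dilation_neg_one_involutive {x : P.Xp} {a : P.Xm} (h : P.Transversal x a) (y : P.Xp) :
    P.dilation (-1) x a (P.dilation (-1) x a y) = y := by
  obtain ⟨τ, hτ⟩ := h.exists_dilation
  obtain ⟨b, hb⟩ := exists_transversal y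
  obtain ⟨h1, h2⟩ := hτ _ _ hb
  obtain ⟨h3, h4⟩ := hτ _ _ h1
  refine (h3.ext hb ?_).1
  rw [h4, h2, h.reflection_reflection]

theorem dilation_neg_one_self {x : P.Xp} {a : P.Xm} (h : P.Transversal x a) :
    P.dilation (-1) x a x = x := by
  obtain ⟨τ, hτ⟩ := h.exists_dilation
  obtain ⟨h1, h2⟩ := hτ _ _ h
  refine (h1.ext h ?_).1
  rw [h2, reflection_self]

/-- On the affine part `𝔳_a` the dilation is given by the structure map `Π`. -/
theorem dilation_neg_one_spec {x y : P.Xp} {a : P.Xm} (hx : P.Transversal x a)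
    (hy : P.Transversal y a) : P.Transversal (P.dilation (-1) x a y) a ∧
      euler (P.dilation (-1) x a y) a = (2 : K) • euler x a - euler y a := by
  obtain ⟨τ, hτ⟩ := hx.exists_dilation
  obtain ⟨h1, h2⟩ := hτ _ _ hx
  rw [reflection_self] at h2
  have e : τ a = a := (h1.ext hx h2).2
  obtain ⟨h3, h4⟩ := hτ _ _ hy
  rw [e] at h3 h4
  exact ⟨h3, h4.trans (hx.reflection_euler_right hy)⟩

theorem dilation_neg_one_eq_piPos {x y : P.Xp} {a : P.Xm} (hx : P.Transversal x a)
    (hy : P.Transversal y a) : P.dilation (-1) x a y = P.piPos (-1) x a y := by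
  obtain ⟨h1, h2⟩ := dilation_neg_one_spec hx hy
  obtain ⟨h3, h4⟩ := piPos_spec (-1) hx hy
  refine (h1.ext h3 ?_).1
  rw [h2, h4]
  module

/-- The symmetry `σ_x` of `U_{a,b}` exchanges `a` and `b`. -/
theorem mul_spec {a b : P.Xm} {x : P.Xp} (hx : x ∈ P.U a b) {y : P.Xp} (hy : y ∈ P.U a b) :
    P.mul a b x y ∈ P.U a b ∧
      euler (P.mul a b x y) a = reflection (euler x (P.midpointMap a b x)) (euler y b) ∧
      euler (P.mul a b x y) b = reflection (euler x (P.midpointMap a b x)) (euler y a) := by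
  obtain ⟨hm, em⟩ := midpointMap_spec hx.1 hx.2
  have e2 : (2 : K) • euler x (P.midpointMap a b x) = euler x a + euler x b := by
    rw [em, smul_smul, mul_invOf_self, one_smul]
  obtain ⟨τ, hτ⟩ := hm.exists_dilation
  have hxx := dilation_neg_one_self hm
  -- The reflection in the mean of `euler x a` and `euler x b` exchanges the two; as `x` is fixed,
  -- the partner map sends `a` to `b`.
  have ta : τ a = b := by
    obtain ⟨h1, h2⟩ := hτ _ _ hx.1
    rw [hm.reflection_euler_left hx.1, e2, add_sub_cancel_left, hxx] at h2
    exact ((hxx ▸ h1).ext hx.2 h2).2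
  have tb : τ b = a := by
    obtain ⟨h1, h2⟩ := hτ _ _ hx.2
    rw [hm.reflection_euler_left hx.2, e2, add_sub_cancel_right, hxx] at h2
    exact ((hxx ▸ h1).ext hx.1 h2).2
  obtain ⟨h1, h2⟩ := hτ _ _ hy.1
  obtain ⟨h3, h4⟩ := hτ _ _ hy.2
  rw [ta] at h1 h2
  rw [tb] at h3 h4
  exact ⟨⟨h3, h1⟩, h4, h2⟩

theorem isSymmetricSpace_U (a b : P.Xm) : P.IsSymmetricSpace (P.U a b) (P.mul a b) where
  closed x hx y hy := (mul_spec hx hy).1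
  s1 x hx := dilation_neg_one_self (midpointMap_spec hx.1 hx.2).1
  s2 x hx y _ := dilation_neg_one_involutive (midpointMap_spec hx.1 hx.2).1 y
  s3 x hx y hy z hz := by
    obtain ⟨hm, -⟩ := midpointMap_spec hx.1 hx.2
    obtain ⟨hmy, emy⟩ := midpointMap_spec hy.1 hy.2
    obtain ⟨h1, h1a, h1b⟩ := mul_spec hx hz
    obtain ⟨h2, h2a, h2b⟩ := mul_spec hy h1
    obtain ⟨h3, h3a, h3b⟩ := mul_spec hx h2
    obtain ⟨h4, h4a, h4b⟩ := mul_spec hx hy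
    obtain ⟨h5, h5a, h5b⟩ := mul_spec h4 hz
    obtain ⟨-, em⟩ := midpointMap_spec h4.1 h4.2
    refine (h3.1.ext h5.1 ?_).1
    -- The symmetry at `x` exchanges `a` and `b`, so it sends the midpoint at `y` to the midpoint at
    -- the image of `y`.
    have e : euler (P.mul a b x y) (P.midpointMap a b (P.mul a b x y)) =
        reflection (euler x (P.midpointMap a b x)) (euler y (P.midpointMap a b y)) := by
      rw [em, emy, h4a, h4b, map_smul, map_add, add_comm]
    rw [h5a, e, hm.reflection_conj, h3a, h2b, h1a]
  s4 x hx := by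
    obtain ⟨hm, -⟩ := midpointMap_spec hx.1 hx.2
    -- The chart for (S4) is the one with `g o⁺ = x` and `g o⁻ = p(x)`, where the symmetry is the
    -- dilation by `-1`.
    obtain ⟨g, h1, h2, h3⟩ := hm.exists_smul
    have h0 : P.chartPos g 0 = x := by
      rw [← h1, chartPos]
      have : P.uPos (0 : Vp) = 1 := by
        apply Subtype.ext
        apply LinearEquiv.ext
        intro z
        rw [coe_uPos, expPos_apply, show ofPos P (0 : Vp) = 0 from rfl]
        simp
      rw [this, one_smul]
    refine ⟨g, h0, fun v => ?_⟩
    have hv := transversal_chartPos g v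
    have hv' := transversal_chartPos g (-v)
    have ev := euler_chartPos g v
    have ev' := euler_chartPos g (-v)
    rw [h2] at hv hv' ev ev'
    obtain ⟨h4, h5⟩ := dilation_neg_one_spec hm hv
    refine (h4.ext hv' ?_).1
    rw [h5, ev, ev', ← h3, ← map_smul, ← map_sub, TKK.ofPos_neg]
    congr 1
    module

end SymmetricSpace

/-! ### Identities in linear Jordan pairs -/

section JordanPairIdentities

variable {K Vp Vm : Type*} [CommRing K] [AddCommGroup Vp] [AddCommGroup Vm]
  [Module K Vp] [Module K Vm] (P : LinearJordanPair K Vp Vm)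

/-- The dual Jordan pair `(V⁻, V⁺)`. -/
def dual : LinearJordanPair K Vm Vp where
  Tp := P.Tm
  Tm := P.Tp
  symm_p := P.symm_m
  symm_m := P.symm_p
  jordan_p := P.jordan_m
  jordan_m := P.jordan_p

/-- Write `A`, `B` for the two sides and `M = T(x, T(y, x, z), x)`. The Jordan identity gives `A =
2B - M` and, with `y` and `z` exchanged, `B = 2A - M`; hence `3A = 3B`. -/
theorem Tp_Tp_left [Invertible (3 : K)] (x : Vp) (y z : Vm) :
    P.Tp x y (P.Tp x z x) = P.Tp (P.Tp x y x) z x := by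
  have h1 := P.jordan_p x y x z x
  have h2 := P.jordan_p x z x y x
  rw [P.symm_p x z (P.Tp x y x)] at h1 h2
  rw [P.symm_p x y (P.Tp x z x)] at h1 h2 ⊢
  rw [P.symm_m z x y] at h2
  apply smul_three_cancel (R := K)
  linear_combination (norm := module) h1 - h2

theorem Tp_Tm_middle [Invertible (3 : K)] (x : Vp) (y z : Vm) :
    P.Tp x (P.Tm y x z) x = P.Tp (P.Tp x y x) z x := by
  have h1 := P.jordan_p x y x z x
  rw [P.symm_p x z (P.Tp x y x), Tp_Tp_left] at h1
  linear_combination (norm := module) h1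

theorem Tp_Tm_self (x z : Vp) (y : Vm) :
    P.Tp x (P.Tm y z y) x = (2 : K) • P.Tp x y (P.Tp x y z) - P.Tp (P.Tp x y x) y z := by
  have h1 := P.jordan_p z y x y x
  rw [P.symm_p z y (P.Tp x y x), P.symm_p z y x, P.symm_p (P.Tp x y z)] at h1
  linear_combination (norm := module) h1

/-- With `D = T(p, q, ·)`, `Tp_Tm_self` and `hp` turn the assumption into `3 D² z - ½ D z = D z`.
The conclusion says that `2D` is idempotent at `z`: there is no Peirce-1 part. -/
theorem two_smul_Tp_Tp [Invertible (2 : K)] [Invertible (3 : K)] {p : Vp} {q : Vm}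
    (hp : (2 : K) • P.Tp p q p = p) {z : Vp}
    (h : P.Tp p q (P.Tp p q z) + P.Tp p (P.Tm q z q) p = P.Tp p q z) :
    (2 : K) • P.Tp p q (P.Tp p q z) = P.Tp p q z := by
  rw [Tp_Tm_self] at h
  have h1 : (2 : K) • P.Tp (P.Tp p q p) q z = P.Tp p q z := by
    have := congrArg (fun t => P.Tp t q z) hp
    simpa using this
  apply smul_three_cancel (R := K)
  linear_combination (norm := module) (2 : K) • h + h1

end JordanPairIdentities

/-! ### Euler operators without degree-zero component -/

section OddEulerOperators

variable {K Vp Vm : Type*} [CommRing K] [AddCommGroup Vp] [AddCommGroup Vm]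
  [Module K Vp] [Module K Vm] {P : LinearJordanPair K Vp Vm}

open TKK (ofPos ofNeg)

theorem lie_lie_ofPos (p z : Vp) (q : Vm) :
    ⁅(⟨p, 0, q⟩ : TKK P), ⁅(⟨p, 0, q⟩ : TKK P), ofPos P z⁆⁆ =
      ofPos P (P.Tp p q z) - ofNeg P (P.Tm q z q) := by
  ext1
  · simp [P.symm_p p q z]
  · apply TKK.der_ext <;> intro v <;> simp
  · simp

theorem lie_lie_ofNeg (p : Vp) (q y : Vm) :
    ⁅(⟨p, 0, q⟩ : TKK P), ⁅(⟨p, 0, q⟩ : TKK P), ofNeg P y⁆⁆ =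
      ofNeg P (P.Tm q p y) - ofPos P (P.Tp p y p) := by
  ext1
  · simp
  · apply TKK.der_ext <;> intro v <;> simp
  · simp [P.symm_m q p y]

theorem lie_odd_eulerOp (p : Vp) (q : Vm) :
    ⁅(⟨p, 0, q⟩ : TKK P), eulerOp P⁆ = ⟨-p, 0, q⟩ :=
  lie_eulerOp _

theorem lie_lie_odd_eulerOp (p : Vp) (q : Vm) :
    ⁅(⟨p, 0, q⟩ : TKK P), ⁅(⟨p, 0, q⟩ : TKK P), eulerOp P⁆⁆ =
      ⟨0, (2 : K) • P.innerDer p q, 0⟩ := by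
  rw [lie_odd_eulerOp]
  ext1
  · simp
  · apply TKK.der_ext <;> intro v <;> simp [two_smul, sub_eq_add_neg]
  · simp

theorem lie_odd_innerDer (p : Vp) (q : Vm) :
    ⁅(⟨p, 0, q⟩ : TKK P), (⟨0, (2 : K) • P.innerDer p q, 0⟩ : TKK P)⁆ =
      ⟨-((2 : K) • P.Tp p q p), 0, (2 : K) • P.Tm q p q⟩ := by
  ext1
  · simp
  · apply TKK.der_ext <;> intro v <;> simp
  · simp

variable [Invertible (2 : K)] [Invertible (3 : K)]

theorem lie_lie_lie_smul_eulerOp (h : P.PE) (a : TKK P) :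
    ⁅(h : TKK P ≃ₗ[K] TKK P) (eulerOp P), ⁅(h : TKK P ≃ₗ[K] TKK P) (eulerOp P),
      ⁅(h : TKK P ≃ₗ[K] TKK P) (eulerOp P), a⁆⁆⁆ =
      ⁅(h : TKK P ≃ₗ[K] TKK P) (eulerOp P), a⁆ := by
  obtain ⟨a, rfl⟩ := (h : TKK P ≃ₗ[K] TKK P).surjective a
  simp only [← PE.map_lie, eulerOp_lie, _root_.neg_neg]

/-- Let `m = (p, 0, q) = h E`, so `(ad m)³ = ad m`. Evaluated on `E` and on `V^±`, this yields the
Peirce relations `hp`, `hq`, `hDp`, `hDm`. The defect `c = E - (ad m)² E` commutes with `m` and, by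
these relations, centralizes the `±1` eigenspaces of `ad m`. Pulled back by `h`, it is a degree-zero
element acting trivially on `V^±`, hence zero. -/
theorem two_smul_innerDer_of_odd (h : P.PE) {p : Vp} {q : Vm}
    (e : (h : TKK P ≃ₗ[K] TKK P) (eulerOp P) = ⟨p, 0, q⟩) :
    (2 : K) • P.innerDer p q = (eulerOp P).zero := by
  have cube : ∀ a : TKK P, ⁅(⟨p, 0, q⟩ : TKK P), ⁅(⟨p, 0, q⟩ : TKK P), ⁅(⟨p, 0, q⟩ : TKK P), a⁆⁆⁆ =
      ⁅(⟨p, 0, q⟩ : TKK P), a⁆ := by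
    rw [← e]
    exact lie_lie_lie_smul_eulerOp h
  have hE := cube (eulerOp P)
  rw [lie_lie_odd_eulerOp, lie_odd_innerDer, lie_odd_eulerOp] at hE
  have hp : (2 : K) • P.Tp p q p = p := neg_injective (congrArg TKK.pos hE)
  have hq : (2 : K) • P.Tm q p q = q := congrArg TKK.neg hE
  have hDp : ∀ z, (2 : K) • P.Tp p q (P.Tp p q z) = P.Tp p q z := by
    intro z
    apply P.two_smul_Tp_Tp hp
    have := congrArg (fun t => ⁅(⟨p, 0, q⟩ : TKK P), t⁆) (cube (ofPos P z))
    simp only [lie_lie_ofPos, lie_sub, lie_lie_ofNeg] at this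
    have := congrArg TKK.pos this
    simpa using this
  have hDm : ∀ y, (2 : K) • P.Tm q p (P.Tm q p y) = P.Tm q p y := by
    intro y
    apply P.dual.two_smul_Tp_Tp hq
    have := congrArg (fun t => ⁅(⟨p, 0, q⟩ : TKK P), t⁆) (cube (ofNeg P y))
    simp only [lie_lie_ofPos, lie_sub, lie_lie_ofNeg] at this
    have := congrArg TKK.neg this
    change P.Tm q p (P.Tm q p y) + P.Tm q (P.Tp p y p) q = P.Tm q p y
    simpa using this
  set m : TKK P := ⟨p, 0, q⟩ with hm
  obtain ⟨c, hc⟩ : ∃ c : TKK P, c = eulerOp P - ⟨0, (2 : K) • P.innerDer p q, 0⟩ := ⟨_, rfl⟩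
  have hmc : ⁅m, c⁆ = 0 := by
    rw [hc, lie_sub, ← lie_lie_odd_eulerOp, cube, sub_self]
  have comm : ∀ a : TKK P, ⁅m, ⁅c, a⁆⁆ = ⁅c, ⁅m, a⁆⁆ := by
    intro a
    rw [leibniz_lie, hmc, zero_lie, zero_add]
  have hcp : ∀ z, ⁅m, ⁅m, ⁅c, ofPos P z⁆⁆⁆ = 0 := by
    intro z
    have h1 : ⁅c, ofPos P z⁆ = ofPos P (z - (2 : K) • P.Tp p q z) := by
      rw [hc]
      ext1
      · simp
      · apply TKK.der_ext <;> intro v <;> simp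
      · simp
    rw [h1, lie_lie_ofPos]
    have h2 : (2 : K) • P.Tm q (P.Tp p q z) q = P.Tm q z q := by
      have h3 := P.dual.Tp_Tm_middle q p z
      change P.Tm q (P.Tp p q z) q = P.Tm (P.Tm q p q) z q at h3
      have h4 := congrArg (fun t => P.Tm t z q) hq
      rw [h3]
      simpa using h4
    ext1
    · simp [hDp]
    · simp
    · simp [h2]
  have hcn : ∀ y, ⁅m, ⁅m, ⁅c, ofNeg P y⁆⁆⁆ = 0 := by
    intro y
    have h1 : ⁅c, ofNeg P y⁆ = -ofNeg P (y - (2 : K) • P.Tm q p y) := by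
      rw [hc]
      ext1
      · simp
      · apply TKK.der_ext <;> intro v <;> simp
      · simp; abel
    rw [h1, lie_neg, lie_neg, lie_lie_ofNeg]
    have h2 : (2 : K) • P.Tp p (P.Tm q p y) p = P.Tp p y p := by
      have h3 := P.Tp_Tm_middle p q y
      have h4 := congrArg (fun t => P.Tp t y p) hp
      rw [h3]
      simpa using h4
    ext1
    · simp [h2]
    · simp
    · simp [hDm]
  have hall : ∀ a : TKK P, ⁅m, ⁅m, ⁅c, a⁆⁆⁆ = 0 := by
    intro a
    have ha : a = ofPos P a.pos + ⟨0, a.zero, 0⟩ + ofNeg P a.neg := by ext1 <;> simp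
    have hz : ⁅m, (⟨0, a.zero, 0⟩ : TKK P)⁆ =
        ofPos P (-a.zero.1.1 p) + ofNeg P (-a.zero.1.2 q) := by
      rw [hm]
      ext1
      · simp
      · apply TKK.der_ext <;> intro v <;> simp
      · simp
    -- Replacing `ad m` by its cube and moving `ad c` inward reduces to `[m, a₀] ∈ V⁺ + V⁻`, where
    -- the claim is already known.
    have h0 : ⁅m, ⁅c, (⟨0, a.zero, 0⟩ : TKK P)⁆⁆ = 0 := by
      rw [← cube, comm, hz]
      simp only [lie_add, hcp, hcn, add_zero]
    rw [ha]
    simp only [lie_add, hcp, hcn, h0, add_zero]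
  -- If `(ad m)² a = a`, then `[c, a] = [c, (ad m)² a] = (ad m)² [c, a] = 0`.
  have hker : ∀ a : TKK P, ⁅m, ⁅m, a⁆⁆ = a → ⁅c, a⁆ = 0 := by
    intro a ha
    rw [← ha, ← comm, ← comm, hall]
  obtain ⟨d, hd⟩ := (h : TKK P ≃ₗ[K] TKK P).surjective c
  have hker' : ∀ a : TKK P, ⁅eulerOp P, ⁅eulerOp P, a⁆⁆ = a → ⁅d, a⁆ = 0 := by
    intro a ha
    apply (h : TKK P ≃ₗ[K] TKK P).injective
    rw [PE.map_lie, hd, map_zero]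
    apply hker
    rw [← e, ← PE.map_lie, ← PE.map_lie, ha]
  have hdE : ⁅eulerOp P, d⁆ = 0 := by
    apply (h : TKK P ≃ₗ[K] TKK P).injective
    rw [PE.map_lie, hd, map_zero, e, hmc]
  rw [eulerOp_lie] at hdE
  have hd0 : d = 0 := by
    ext1
    · simpa using congrArg TKK.pos hdE
    · apply TKK.der_ext <;> intro v
      · have := hker' (ofPos P v) (by simp only [eulerOp_lie]; ext1 <;> simp)
        simpa using congrArg TKK.pos this
      · have := hker' (ofNeg P v) (by simp only [eulerOp_lie]; ext1 <;> simp)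
        simpa using congrArg TKK.neg this
    · simpa using congrArg TKK.neg hdE
  rw [hd0, map_zero, hc] at hd
  exact (sub_eq_zero.1 (congrArg TKK.zero hd.symm : _ - _ = (0 : P.der))).symm

end OddEulerOperators
end LinearJordanPair
open LinearJordanPair

/-! ### Invertibility in a Jordan algebra in terms of the triple product -/

section JordanAlgebraIdentities

variable (K : Type*) {J : Type*} [CommRing K] [NonAssocCommRing J] [IsCommJordan J] [Module K J]
  [IsScalarTower K J J] [SMulCommClass K J J] [Invertible (2 : K)]

omit [IsCommJordan J] in
theorem jordanTriple_self (x y : J) : jordanTriple K J x y x = (2 : K) • jordanU K x y := by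
  rw [jordanTriple_apply]
  congr 1
  simp only [jordanU, two_smul, LinearMap.sub_apply, LinearMap.add_apply, Module.End.mul_apply,
    jordanL_apply]
  rw [mul_comm (x * y) x, mul_comm y x, mul_comm y (x * x)]

omit [IsCommJordan J] in
theorem jordanTriple_one_one (z : J) : jordanTriple K J 1 1 z = (2 : K) • z := by
  rw [jordanTriple_apply]
  simp

/-- `y` plays the role of `-v⁻¹`. By `Tp_Tm_self`, `4 U_v U_y z = 2·4z - 4z`, so `U_v U_y = 1`, and
symmetrically `U_y U_v = 1`. -/
theorem mem_jordanUnits_of_jordanTriple {v y : J}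
    (h1 : ∀ z, jordanTriple K J v y z = -((2 : K) • z))
    (h2 : ∀ z, jordanTriple K J y v z = -((2 : K) • z)) : v ∈ jordanUnits K J := by
  have key : ∀ {v y : J}, (∀ z, jordanTriple K J v y z = -((2 : K) • z)) →
      jordanU K v * jordanU K y = 1 := by
    intro v y h
    ext z
    have h3 := (jordanPair K J).Tp_Tm_self v z y
    change jordanTriple K J v (jordanTriple K J y z y) v =
      (2 : K) • jordanTriple K J v y (jordanTriple K J v y z) -
        jordanTriple K J (jordanTriple K J v y v) y z at h3
    have h4 : jordanTriple K J (jordanTriple K J v y v) y z = (4 : K) • z := by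
      rw [h, jordanTriple_symm, map_neg, map_smul, jordanTriple_symm, h]
      module
    rw [h4, jordanTriple_self K y, map_smul, LinearMap.smul_apply, jordanTriple_self K v] at h3
    simp only [h] at h3
    apply smul_two_cancel (R := K)
    apply smul_two_cancel (R := K)
    simp only [Module.End.mul_apply, Module.End.one_apply]
    rw [h3]
    module
  exact ⟨⟨jordanU K v, jordanU K y, key h1, key h2⟩, rfl⟩

variable {K}

omit [IsCommJordan J] [IsScalarTower K J J] [Invertible (2 : K)] in
theorem jordanU_jordanInv {v : J} (hv : v ∈ jordanUnits K J) :
    jordanU K v (jordanInv K v) = v := by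
  have := DFunLike.congr_fun (Ring.mul_inverse_cancel _ (show IsUnit (jordanU K v) from hv)) v
  exact this

/-- Writing the argument as `U_v z'`, the identity `Tp_Tp_left` moves the operator onto `T(v, v⁻¹,
v) = 2v`; this uses surjectivity of `U_v`. -/
theorem jordanTriple_jordanInv_right [Invertible (3 : K)] {v : J} (hv : v ∈ jordanUnits K J)
    (z : J) : jordanTriple K J v (jordanInv K v) z = (2 : K) • z := by
  have h := (jordanPair K J).Tp_Tp_left v (jordanInv K v) (Ring.inverse (jordanU K v) z)
  change jordanTriple K J v (jordanInv K v) (jordanTriple K J v _ v) =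
    jordanTriple K J (jordanTriple K J v (jordanInv K v) v) _ v at h
  have e : jordanU K v (Ring.inverse (jordanU K v) z) = z :=
    DFunLike.congr_fun (Ring.mul_inverse_cancel _ (show IsUnit (jordanU K v) from hv)) z
  rw [jordanTriple_self, jordanTriple_self, e, jordanU_jordanInv hv, map_smul, map_smul,
    LinearMap.smul_apply, LinearMap.smul_apply, jordanTriple_self, e] at h
  exact smul_two_cancel (R := K) h

/-- Here injectivity of `U_v` is used: after applying `U_v`, the identity reduces to the right-hand
version. -/
theorem jordanTriple_jordanInv_left [Invertible (3 : K)] {v : J} (hv : v ∈ jordanUnits K J)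
    (z : J) : jordanTriple K J (jordanInv K v) v z = (2 : K) • z := by
  have h := (jordanPair K J).Tp_Tm_middle v (jordanInv K v) z
  rw [← Tp_Tp_left] at h
  change jordanTriple K J v (jordanTriple K J (jordanInv K v) v z) v =
    jordanTriple K J v (jordanInv K v) (jordanTriple K J v _ v) at h
  rw [jordanTriple_jordanInv_right hv, jordanTriple_self, jordanTriple_self] at h
  have h' := smul_two_cancel (R := K) h
  rw [← map_smul] at h'
  obtain ⟨i, hi⟩ := (show IsUnit (jordanU K v) from hv)
  have := congrArg (fun t => (i⁻¹ : (Module.End K J)ˣ).1 t) h'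
  have e : ∀ t, (i⁻¹ : (Module.End K J)ˣ).1 (jordanU K v t) = t := by
    intro t
    rw [← hi]
    exact DFunLike.congr_fun i.inv_mul t
  simpa only [e] using this

end JordanAlgebraIdentities

/-! ### The element `w` and the canonical identification -/

section CanonicalIdentification

variable {K J : Type*} [CommRing K] [NonAssocCommRing J] [IsCommJordan J] [Module K J]
  [IsScalarTower K J J] [SMulCommClass K J J] [Invertible (2 : K)]

open LinearJordanPair.TKK (ofPos ofNeg)

theorem jordanPair_Tp (x y z : J) : (jordanPair K J).Tp x y z = jordanTriple K J x y z := rfl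
theorem jordanPair_Tm (x y z : J) : (jordanPair K J).Tm x y z = jordanTriple K J x y z := rfl

theorem expNeg_ofPos {Vp Vm : Type*} [AddCommGroup Vp] [AddCommGroup Vm]
    [Module K Vp] [Module K Vm] (P : LinearJordanPair K Vp Vm) (x : Vp) (y : Vm) :
    P.expNeg y (ofPos P x) = ⟨x, -P.innerDer x y, -((⅟2 : K) • P.Tm y x y)⟩ := by
  rw [expNeg_apply]
  ext1
  · simp
  · apply TKK.der_ext <;> intro v <;> simp
  · simp

theorem expPos_eulerOp_add_ofNeg {Vp Vm : Type*} [AddCommGroup Vp] [AddCommGroup Vm]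
    [Module K Vp] [Module K Vm] (P : LinearJordanPair K Vp Vm) (x : Vp) (y : Vm) :
    P.expPos x (eulerOp P + ofNeg P y) =
      ⟨-x - (⅟2 : K) • P.Tp x y x, (eulerOp P).zero + P.innerDer x y, y⟩ := by
  rw [expPos_apply]
  ext1
  · simp [sub_eq_add_neg]
  · apply TKK.der_ext <;> intro v <;> simp
  · simp

/-- The three factors move `E` to `E - 1⁺`, then to `-(E + 1⁺)`, then to `-E`. Consequently `w`
exchanges `V⁺` and `V⁻`, and conjugation by it exchanges `P⁺` and `P⁻`. -/
theorem weyl_eulerOp : (weyl K J : TKK (jordanPair K J) ≃ₗ[K] TKK (jordanPair K J))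
    (eulerOp (jordanPair K J)) = -eulerOp (jordanPair K J) := by
  rw [weyl, PE.mul_apply, PE.mul_apply, coe_uPos, coe_uNeg, expPos_eulerOp]
  have h : (jordanPair K J).expNeg (-1) (eulerOp _ + ofPos _ (-1)) =
      -(eulerOp _ + ofPos _ 1) := by
    rw [map_add, expNeg_eulerOp, expNeg_ofPos]
    ext1
    · simp
    · apply TKK.der_ext <;> intro v <;>
        simp [jordanPair_Tp, jordanPair_Tm, jordanTriple_one_one, two_smul]
    · simp [jordanPair_Tm, jordanTriple_one_one]
  rw [h, map_neg, expPos_eulerOp_add, sub_self]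
  congr 1
  exact add_zero _

variable [Invertible (3 : K)]

theorem exists_weyl_ofPos (y : J) : ∃ x,
    (weyl K J : TKK (jordanPair K J) ≃ₗ[K] TKK (jordanPair K J)) (ofPos _ x) = ofNeg _ y := by
  obtain ⟨z, hz⟩ := (weyl K J : TKK (jordanPair K J) ≃ₗ[K] TKK (jordanPair K J)).surjective
    (ofNeg _ y)
  have h : z ∈ TKK.gradePos (jordanPair K J) := by
    rw [TKK.mem_gradePos_iff_lie]
    apply (weyl K J : TKK (jordanPair K J) ≃ₗ[K] TKK (jordanPair K J)).injective
    rw [PE.map_lie, weyl_eulerOp, neg_lie, hz,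
      (TKK.mem_gradeNeg_iff_lie _).1 (show ofNeg _ y ∈ _ from ⟨rfl, rfl⟩), neg_neg]
  refine ⟨z.pos, ?_⟩
  rw [← hz]
  congr 1
  ext1
  · rfl
  · exact h.1.symm
  · exact h.2.symm

theorem exists_weyl_eq_ofNeg (x : J) : ∃ y,
    (weyl K J : TKK (jordanPair K J) ≃ₗ[K] TKK (jordanPair K J)) (ofPos _ x) = ofNeg _ y := by
  have h : (weyl K J : TKK (jordanPair K J) ≃ₗ[K] TKK (jordanPair K J)) (ofPos _ x) ∈
      TKK.gradeNeg (jordanPair K J) := by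
    have h1 := (TKK.mem_gradePos_iff_lie (ofPos (jordanPair K J) x)).1 ⟨rfl, rfl⟩
    have h2 := congrArg (weyl K J : TKK (jordanPair K J) ≃ₗ[K] TKK (jordanPair K J)) h1
    rw [PE.map_lie, weyl_eulerOp, neg_lie] at h2
    rw [TKK.mem_gradeNeg_iff_lie, ← h2, neg_neg, h2]
  refine ⟨((weyl K J : TKK (jordanPair K J) ≃ₗ[K] TKK (jordanPair K J)) (ofPos _ x)).neg, ?_⟩
  ext1
  · exact h.1
  · exact h.2
  · rfl

omit [Invertible (3 : K)] in
theorem weyl_symm_eulerOp : (weyl K J : TKK (jordanPair K J) ≃ₗ[K] TKK (jordanPair K J)).symm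
    (eulerOp (jordanPair K J)) = -eulerOp (jordanPair K J) := by
  rw [LinearEquiv.symm_apply_eq, map_neg, weyl_eulerOp, neg_neg]

theorem weyl_conj_mem_paraPos {k : (jordanPair K J).PE} (hk : k ∈ (jordanPair K J).paraNeg) :
    (weyl K J)⁻¹ * k * weyl K J ∈ (jordanPair K J).paraPos := by
  obtain ⟨y, hy⟩ := (mem_paraNeg_iff k).1 hk
  obtain ⟨x, hx⟩ := exists_weyl_ofPos (K := K) (-y)
  refine (mem_paraPos_iff _).2 ⟨x, ?_⟩
  rw [mul_assoc, PE.inv_mul_apply, LinearEquiv.symm_apply_eq, PE.mul_apply, weyl_eulerOp,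
    map_neg, hy, map_add, weyl_eulerOp, hx, TKK.ofNeg_neg]
  abel

theorem weyl_conj_mem_paraNeg {k : (jordanPair K J).PE} (hk : k ∈ (jordanPair K J).paraPos) :
    weyl K J * k * (weyl K J)⁻¹ ∈ (jordanPair K J).paraNeg := by
  obtain ⟨x, hx⟩ := (mem_paraPos_iff k).1 hk
  obtain ⟨y, hy⟩ := exists_weyl_eq_ofNeg (K := K) x
  refine (mem_paraNeg_iff _).2 ⟨-y, ?_⟩
  rw [PE.mul_apply, PE.mul_apply]
  change (weyl K J).1 (k.1 ((weyl K J).1.symm _)) = _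
  rw [weyl_symm_eulerOp, map_neg, hx, map_neg, map_add, weyl_eulerOp, hy, TKK.ofNeg_neg]
  abel

variable (K J) in
/-- The canonical identification `g P⁻ ↦ g w P⁺`. -/
def canonicalIdentification : (jordanPair K J).Xp ≃ (jordanPair K J).Xm where
  toFun := Quotient.map' (fun g => g * weyl K J) (by
    intro g h hgh
    rw [QuotientGroup.leftRel_apply] at hgh ⊢
    have := weyl_conj_mem_paraPos hgh
    convert this using 1
    group)
  invFun := Quotient.map' (fun g => g * (weyl K J)⁻¹) (by
    intro g h hgh
    rw [QuotientGroup.leftRel_apply] at hgh ⊢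
    have := weyl_conj_mem_paraNeg hgh
    convert this using 1
    group)
  left_inv x := by
    obtain ⟨g, rfl⟩ := QuotientGroup.mk_surjective x
    change ((g * weyl K J * (weyl K J)⁻¹ : (jordanPair K J).PE) : (jordanPair K J).Xp) = _
    rw [mul_inv_cancel_right]
  right_inv x := by
    obtain ⟨g, rfl⟩ := QuotientGroup.mk_surjective x
    change ((g * (weyl K J)⁻¹ * weyl K J : (jordanPair K J).PE) : (jordanPair K J).Xm) = _
    rw [inv_mul_cancel_right]

theorem isCanonicalIdentification_canonicalIdentification :
    IsCanonicalIdentification K (canonicalIdentification K J) := by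
  intro g
  change ((g * 1 * weyl K J : (jordanPair K J).PE) : (jordanPair K J).Xm) =
    ((g * (weyl K J * 1) : (jordanPair K J).PE) : (jordanPair K J).Xm)
  rw [mul_one, mul_one]

/-- The canonical identification acts on Euler operators by `-1`. -/
theorem IsCanonicalIdentification.transversal {n : (jordanPair K J).Xp ≃ (jordanPair K J).Xm}
    (hn : IsCanonicalIdentification K n) {x : (jordanPair K J).Xp} {a : (jordanPair K J).Xm}
    (h : (jordanPair K J).Transversal x a) :
    (jordanPair K J).Transversal (n.symm a) (n x) ∧ euler (n.symm a) (n x) = -euler x a := by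
  obtain ⟨g, rfl, rfl, e⟩ := h.exists_smul
  have h1 : n.symm (g • (jordanPair K J).om) = (g * weyl K J) • (jordanPair K J).op := by
    rw [Equiv.symm_apply_eq, hn, mul_smul]
    -- `w²` fixes `E`, hence `o⁻`; therefore `n` sends `g w o⁺` back to `g o⁻`.
    have := smul_om_eq_of_eulerOp_eq (P := jordanPair K J) (x := 0) (g := 1)
      (h := weyl K J * weyl K J) (by
        rw [PE.mul_apply, weyl_eulerOp, map_neg, weyl_eulerOp, neg_neg,
          show ofPos (jordanPair K J) (0 : J) = 0 from rfl, add_zero]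
        rfl)
    rw [one_smul, mul_smul] at this
    rw [← this]
  rw [h1, hn, ← mul_smul]
  refine ⟨transversal_smul _, ?_⟩
  rw [euler_smul, PE.mul_apply, weyl_eulerOp, map_neg, e]

end CanonicalIdentification
namespace LinearJordanPair

/-! ### A criterion for polarities -/

section Polarity

variable {K Vp Vm : Type*} [CommRing K] [AddCommGroup Vp] [AddCommGroup Vm]
  [Module K Vp] [Module K Vm] {P : LinearJordanPair K Vp Vm}
  [Invertible (2 : K)] [Invertible (3 : K)]

/-- A bijection `X⁺ → X⁻` which is induced by a linear map on Euler operators is a polarity as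
soon as it has a non-isotropic point. -/
theorem isPolarity_of_euler (f : P.Xp ≃ P.Xm) (Φ : TKK P →ₗ[K] TKK P)
    (hf : ∀ x a, P.Transversal x a → P.Transversal (f.symm a) (f x) ∧
      euler (f.symm a) (f x) = Φ (euler x a))
    (h0 : ∃ x, P.Transversal x (f x)) : P.IsPolarity f where
  transversal x a := ⟨fun h => (hf x a h).1, fun h => by simpa using (hf _ _ h).1⟩
  map_piPos r x a y hx hy := by
    obtain ⟨h1, h2⟩ := piPos_spec r hx hy
    obtain ⟨h3, h4⟩ := hf _ _ h1
    obtain ⟨h5, h6⟩ := piNeg_spec r (hf _ _ hx).1 (hf _ _ hy).1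
    refine (h3.ext h5 ?_).2
    rw [h4, h6, h2, (hf _ _ hx).2, (hf _ _ hy).2, map_add, map_smul, map_smul]
  map_piNeg r a x b ha hb := by
    obtain ⟨h1, h2⟩ := piNeg_spec r ha hb
    obtain ⟨h3, h4⟩ := hf _ _ h1
    obtain ⟨h5, h6⟩ := piPos_spec r (hf _ _ ha).1 (hf _ _ hb).1
    refine (h3.ext h5 ?_).1
    rw [h4, h6, h2, (hf _ _ ha).2, (hf _ _ hb).2, map_add, map_smul, map_smul]
  map_sigmaPos x a y z hx hy hz := by
    obtain ⟨h1, h2⟩ := sigmaPos_spec hx hy hz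
    obtain ⟨h3, h4⟩ := hf _ _ h1
    obtain ⟨h5, h6⟩ := sigmaNeg_spec (hf _ _ hx).1 (hf _ _ hy).1 (hf _ _ hz).1
    refine (h3.ext h5 ?_).2
    rw [h4, h6, h2, (hf _ _ hx).2, (hf _ _ hy).2, (hf _ _ hz).2, map_sub, map_add]
  map_sigmaNeg a x b c ha hb hc := by
    obtain ⟨h1, h2⟩ := sigmaNeg_spec ha hb hc
    obtain ⟨h3, h4⟩ := hf _ _ h1
    obtain ⟨h5, h6⟩ := sigmaPos_spec (hf _ _ ha).1 (hf _ _ hb).1 (hf _ _ hc).1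
    refine (h3.ext h5 ?_).1
    rw [h4, h6, h2, (hf _ _ ha).2, (hf _ _ hb).2, (hf _ _ hc).2, map_sub, map_add]
  nonisotropic := h0

theorem chartPos_injective (g : P.PE) : Function.Injective (P.chartPos g) := by
  intro v v' h
  have e := euler_chartPos g v
  rw [h, euler_chartPos, EmbeddingLike.apply_eq_iff_eq] at e
  simpa using (congrArg TKK.pos e).symm

end Polarity

end LinearJordanPair

/-! ### `J^×` in an affine chart -/

section JordanUnits

variable {K J : Type*} [CommRing K] [NonAssocCommRing J] [IsCommJordan J] [Module K J]
  [IsScalarTower K J J] [SMulCommClass K J J] [Invertible (2 : K)] [Invertible (3 : K)]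

open LinearJordanPair.TKK (ofPos ofNeg)

/-- The element `g exp(v) exp(y)` realizes transversality, since `exp(v)(E + y) = y - E`. Phrasing
the hypotheses through `y` rather than `v⁻¹` lets the lemma be applied to `-v` without computing its
inverse. -/
theorem transversal_chartPos_weyl (g : (jordanPair K J).PE) {v y : J}
    (h1 : ∀ z, jordanTriple K J v y z = -((2 : K) • z))
    (h2 : ∀ z, jordanTriple K J y v z = -((2 : K) • z)) :
    (jordanPair K J).Transversal ((jordanPair K J).chartPos g v)
        (g • weyl K J • (jordanPair K J).om) ∧
      euler ((jordanPair K J).chartPos g v) (g • weyl K J • (jordanPair K J).om) =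
        (g : TKK (jordanPair K J) ≃ₗ[K] TKK (jordanPair K J)) (ofNeg _ y - eulerOp _) := by
  have hE : (jordanPair K J).expPos v (eulerOp _ + ofNeg _ y) = ofNeg _ y - eulerOp _ := by
    rw [expPos_eulerOp_add_ofNeg]
    ext1
    · simp [jordanPair_Tp, h1]
    · apply TKK.der_ext <;> intro z <;>
        simp [jordanPair_Tp, jordanPair_Tm, h1, h2, two_smul]
    · simp
  have hk : (((g * (jordanPair K J).uPos v) * (jordanPair K J).uNeg y : (jordanPair K J).PE) :
      TKK (jordanPair K J) ≃ₗ[K] TKK (jordanPair K J)) (eulerOp _) =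
      (g : TKK (jordanPair K J) ≃ₗ[K] TKK (jordanPair K J)) (ofNeg _ y - eulerOp _) := by
    rw [PE.mul_apply, PE.mul_apply, coe_uPos, coe_uNeg, expNeg_eulerOp, hE]
  have hop : ((g * (jordanPair K J).uPos v) * (jordanPair K J).uNeg y) • (jordanPair K J).op =
      (jordanPair K J).chartPos g v := by
    rw [mul_smul, uNeg_smul_op, mul_smul, chartPos]
  obtain ⟨x, hx⟩ := exists_weyl_ofPos (K := K) y
  have hom : ((g * (jordanPair K J).uPos v) * (jordanPair K J).uNeg y) • (jordanPair K J).om =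
      g • weyl K J • (jordanPair K J).om := by
    rw [← mul_smul g]
    refine (smul_om_eq_of_eulerOp_eq (x := x) ?_).symm
    rw [hk, PE.mul_apply, map_add (weyl K J).1, weyl_eulerOp, hx, neg_add_eq_sub]
  rw [← hop, ← hom]
  exact ⟨transversal_smul _, by rw [euler_smul, hk]⟩

/-- Comparing degree-zero components of the two expressions for the Euler operator gives `D(v, y) =
-2E`, the criterion for invertibility. -/
theorem mem_jordanUnits_of_transversal {g : (jordanPair K J).PE} {v : J}
    (h : (jordanPair K J).Transversal ((jordanPair K J).chartPos g v)
      (g • weyl K J • (jordanPair K J).om)) : v ∈ jordanUnits K J := by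
  obtain ⟨k, h1, h2, -⟩ := h.exists_smul
  rw [chartPos, ← mul_smul] at h1
  rw [← mul_smul] at h2
  obtain ⟨y, hy⟩ := exists_of_smul_op_eq h1.symm
  obtain ⟨x, hx⟩ := exists_of_smul_om_eq h2.symm
  obtain ⟨y', hy'⟩ := exists_weyl_eq_ofNeg (K := K) x
  rw [hx, PE.mul_apply, PE.mul_apply, EmbeddingLike.apply_eq_iff_eq, coe_uPos, map_add,
    weyl_eulerOp, hy', expPos_eulerOp_add_ofNeg] at hy
  have hz := congrArg TKK.zero hy
  refine mem_jordanUnits_of_jordanTriple K (y := y) (fun z => ?_) (fun z => ?_)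
  · have := DFunLike.congr_fun (congrArg (fun t => t.1.1) hz) z
    simp [jordanPair_Tp] at this
    rw [two_smul]
    linear_combination (norm := module) -this
  · have := DFunLike.congr_fun (congrArg (fun t => t.1.2) hz) z
    simp [jordanPair_Tm] at this
    rw [two_smul]
    linear_combination (norm := module) this

theorem transversal_chartPos_of_mem_jordanUnits (g : (jordanPair K J).PE) {v : J}
    (hv : v ∈ jordanUnits K J) :
    (jordanPair K J).Transversal ((jordanPair K J).chartPos g v)
        (g • weyl K J • (jordanPair K J).om) ∧
      euler ((jordanPair K J).chartPos g v) (g • weyl K J • (jordanPair K J).om) =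
        (g : TKK (jordanPair K J) ≃ₗ[K] TKK (jordanPair K J))
          (ofNeg _ (-jordanInv K v) - eulerOp _) :=
  transversal_chartPos_weyl g (fun z => by simp [jordanTriple_jordanInv_right hv])
    (fun z => by simp [jordanTriple_jordanInv_left hv])

omit [Invertible (3 : K)] in
theorem one_mem_jordanUnits : (1 : J) ∈ jordanUnits K J :=
  mem_jordanUnits_of_jordanTriple K (y := -1) (fun z => by simp [jordanTriple_one_one])
    (fun z => by simp [jordanTriple_one_one])

/-- An affine chart of `𝔳_b` restricts to a bijection of `J^×` onto `U_{a,b}`. -/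
theorem bijOn_chartPos (g : (jordanPair K J).PE) :
    Set.BijOn ((jordanPair K J).chartPos g) (jordanUnits K J)
      ((jordanPair K J).U (g • weyl K J • (jordanPair K J).om) (g • (jordanPair K J).om)) := by
  refine ⟨fun v hv => ⟨(transversal_chartPos_of_mem_jordanUnits g hv).1,
    transversal_chartPos g v⟩, (chartPos_injective g).injOn, ?_⟩
  rintro x ⟨h1, h2⟩
  obtain ⟨v, rfl⟩ := h2.exists_chartPos
  exact ⟨v, mem_jordanUnits_of_transversal h1, rfl⟩

theorem euler_midpointMap_chartPos (g : (jordanPair K J).PE) {v : J}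
    (hv : v ∈ jordanUnits K J) :
    euler ((jordanPair K J).chartPos g v)
      ((jordanPair K J).midpointMap (g • weyl K J • (jordanPair K J).om)
        (g • (jordanPair K J).om) ((jordanPair K J).chartPos g v)) =
      (g : TKK (jordanPair K J) ≃ₗ[K] TKK (jordanPair K J))
        ((⅟2 : K) • ⟨-v, 0, -jordanInv K v⟩) := by
  obtain ⟨h1, h2⟩ := transversal_chartPos_of_mem_jordanUnits g hv
  rw [(midpointMap_spec h1 (transversal_chartPos g v)).2, h2, euler_chartPos, ← map_add,
    ← map_smul]
  congr 2
  ext1 <;> simp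

/-- This is where the quadratic operator enters: with `c = y⁻¹`, the left side is the reflected
Euler operator of `(y, a)`, the right side that of `(U_v y⁻¹, b)`. -/
theorem reflection_midpoint {v : J} (hv : v ∈ jordanUnits K J) (c : J) :
    reflection ((⅟2 : K) • (⟨-v, 0, -jordanInv K v⟩ : TKK (jordanPair K J)))
      (ofNeg _ (-c) - eulerOp _) = eulerOp _ - ofPos _ (jordanU K v c) := by
  have h1 : ⁅(⟨-v, 0, -jordanInv K v⟩ : TKK (jordanPair K J)),
      (ofNeg (jordanPair K J) (-c) - eulerOp (jordanPair K J))⁆ =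
      ⟨-v, (jordanPair K J).innerDer v c, jordanInv K v⟩ := by
    rw [lie_sub, lie_eulerOp]
    ext1
    · simp
    · apply TKK.der_ext <;> intro z <;> simp
    · simp
  have h2 : ⁅(⟨-v, 0, -jordanInv K v⟩ : TKK (jordanPair K J)),
      (⟨-v, (jordanPair K J).innerDer v c, jordanInv K v⟩ : TKK (jordanPair K J))⁆ =
      (2 : K) • (ofPos (jordanPair K J) (jordanU K v c) - (2 : K) • eulerOp _
        - ofNeg _ c) := by
    ext1
    · simp [jordanPair_Tp, jordanTriple_self]
    · apply TKK.der_ext <;> intro z <;>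
        simp [jordanPair_Tp, jordanPair_Tm, jordanTriple_jordanInv_right hv,
          jordanTriple_jordanInv_left hv, two_smul]
      all_goals abel
    · simp [jordanPair_Tm, jordanTriple_symm K c, jordanTriple_jordanInv_left hv]
  rw [reflection_apply, smul_lie, smul_lie, lie_smul, h1, h2]
  have : (2 : K) • (⅟2 : K) • (⅟2 : K) • (2 : K) •
      (ofPos (jordanPair K J) (jordanU K v c) - (2 : K) • eulerOp _ - ofNeg _ c) =
      ofPos (jordanPair K J) (jordanU K v c) - (2 : K) • eulerOp _ - ofNeg _ c := by
    simp [smul_smul]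
  rw [this, TKK.ofNeg_neg]
  module

/-- The chart transports the product `U_x y⁻¹` of `J^×` to the product of `U_{a,b}`. -/
theorem chartPos_jordanMul (g : (jordanPair K J).PE) {x y : J}
    (hx : x ∈ jordanUnits K J) (hy : y ∈ jordanUnits K J) :
    jordanMul K x y ∈ jordanUnits K J ∧
      (jordanPair K J).chartPos g (jordanMul K x y) =
        (jordanPair K J).mul (g • weyl K J • (jordanPair K J).om) (g • (jordanPair K J).om)
          ((jordanPair K J).chartPos g x) ((jordanPair K J).chartPos g y) := by
  have hm := (bijOn_chartPos (K := K) g).mapsTo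
  obtain ⟨h1, -, h2⟩ := mul_spec (hm hx) (hm hy)
  have e : (jordanPair K J).chartPos g (jordanMul K x y) =
      (jordanPair K J).mul (g • weyl K J • (jordanPair K J).om) (g • (jordanPair K J).om)
        ((jordanPair K J).chartPos g x) ((jordanPair K J).chartPos g y) := by
    refine ((transversal_chartPos g _).ext h1.2 ?_).1
    rw [h2, euler_chartPos, euler_midpointMap_chartPos g hx,
      (transversal_chartPos_of_mem_jordanUnits g hy).2, reflection_map, reflection_midpoint hx,
      jordanMul]
  rw [← e] at h1
  -- Closure of `J^×` under the product is inherited from `U_{a,b}`.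
  exact ⟨mem_jordanUnits_of_transversal h1.1, e⟩

end JordanUnits

/-! ### The polarity extending the midpoint map -/

section PolarityOfPair

variable {K J : Type*} [CommRing K] [NonAssocCommRing J] [IsCommJordan J] [Module K J]
  [IsScalarTower K J J] [SMulCommClass K J J] [Invertible (2 : K)] [Invertible (3 : K)]

open LinearJordanPair.TKK (ofPos ofNeg)

/-- The dilation `(-1)_{x,b}` as a permutation of `X⁺`. -/
noncomputable def LinearJordanPair.Transversal.symmetry {x : (jordanPair K J).Xp}
    {b : (jordanPair K J).Xm} (h : (jordanPair K J).Transversal x b) :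
    Equiv.Perm (jordanPair K J).Xp :=
  Function.Involutive.toPerm _ (dilation_neg_one_involutive h)

/-- Both `n` and the dilation act on Euler operators by linear maps, `-1` and a reflection. This
feeds `isPolarity_of_euler`. -/
theorem polarity_spec {n : (jordanPair K J).Xp ≃ (jordanPair K J).Xm}
    (hn : IsCanonicalIdentification K n) {x₀ : (jordanPair K J).Xp} {b : (jordanPair K J).Xm}
    (h : (jordanPair K J).Transversal x₀ b) (x : (jordanPair K J).Xp) (c : (jordanPair K J).Xm)
    (hx : (jordanPair K J).Transversal x c) :
    (jordanPair K J).Transversal ((h.symmetry.trans n).symm c) (h.symmetry.trans n x) ∧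
      euler ((h.symmetry.trans n).symm c) (h.symmetry.trans n x) =
        -reflection (euler x₀ b) (euler x c) := by
  change (jordanPair K J).Transversal ((jordanPair K J).dilation (-1) x₀ b (n.symm c))
      (n ((jordanPair K J).dilation (-1) x₀ b x)) ∧
    euler ((jordanPair K J).dilation (-1) x₀ b (n.symm c))
      (n ((jordanPair K J).dilation (-1) x₀ b x)) = _
  obtain ⟨τ, hτ⟩ := h.exists_dilation
  obtain ⟨h1, h2⟩ := hτ _ _ hx
  obtain ⟨h3, h4⟩ := hn.transversal h1
  obtain ⟨h5, h6⟩ := hn.transversal hx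
  obtain ⟨h7, h8⟩ := hτ _ _ h5
  -- The reflection commutes with `-1`, so `n` intertwines the dilation with its partner `τ` on
  -- `X⁻`; this identifies the inverse of the composite.
  have e : euler (n.symm (τ c)) (n ((jordanPair K J).dilation (-1) x₀ b x)) =
      euler ((jordanPair K J).dilation (-1) x₀ b (n.symm c)) (τ (n x)) := by
    rw [h4, h2, h8, h6, map_neg]
  have e1 := (h3.ext h7 e).1
  rw [← e1]
  exact ⟨h3, by rw [h4, h2]⟩

/-- The dilation sends `v` to `-v`, which flips the sign of the midpoint's Euler operator `-½ g (v,
0, v⁻¹)`; `n` flips it back. -/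
theorem polarity_eq_midpointMap {n : (jordanPair K J).Xp ≃ (jordanPair K J).Xm}
    (hn : IsCanonicalIdentification K n) (g : (jordanPair K J).PE) {v : J}
    (hv : v ∈ jordanUnits K J) :
    (transversal_smul (P := jordanPair K J) g).symmetry.trans n
      ((jordanPair K J).chartPos g v) =
    (jordanPair K J).midpointMap (g • weyl K J • (jordanPair K J).om)
      (g • (jordanPair K J).om) ((jordanPair K J).chartPos g v) := by
  have h0 := transversal_smul (P := jordanPair K J) g
  have hv0 := transversal_chartPos (P := jordanPair K J) g v
  have e0 : (jordanPair K J).dilation (-1) (g • (jordanPair K J).op)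
      (g • (jordanPair K J).om) ((jordanPair K J).chartPos g v) =
      (jordanPair K J).chartPos g (-v) := by
    obtain ⟨h1, h2⟩ := dilation_neg_one_spec h0 hv0
    refine (h1.ext (transversal_chartPos g (-v)) ?_).1
    rw [h2, euler_chartPos, euler_chartPos, euler_smul, ← map_smul, ← map_sub, TKK.ofPos_neg]
    congr 1
    module
  change n ((jordanPair K J).dilation (-1) (g • (jordanPair K J).op)
      (g • (jordanPair K J).om) ((jordanPair K J).chartPos g v)) = _
  rw [e0]
  obtain ⟨h1, h2⟩ := transversal_chartPos_weyl g (v := -v) (y := jordanInv K v)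
    (fun z => by simp [jordanTriple_jordanInv_right hv])
    (fun z => by simp [jordanTriple_jordanInv_left hv])
  obtain ⟨h3, h4⟩ := midpointMap_spec h1 (transversal_chartPos g (-v))
  obtain ⟨h5, h6⟩ := hn.transversal h3
  obtain ⟨h7, -⟩ := midpointMap_spec (transversal_chartPos_of_mem_jordanUnits g hv).1 hv0
  refine (h5.ext h7 ?_).2
  rw [h6, euler_midpointMap_chartPos g hv, h4, h2, euler_chartPos, ← map_add, ← map_smul,
    ← map_neg]
  congr 1
  ext1 <;> simp

/-- The Euler operator `g m` of `(x, f(x))` is invariant under minus the reflection, so `m = (p, 0,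
q)` is odd and `2 D(p, q) = E`. Adding elements of the `-1` eigenspace keeps `x` and moves the
second entry along its affine part, up to `a` and `b`. -/
theorem transversal_polarity_imp_mem_U {n : (jordanPair K J).Xp ≃ (jordanPair K J).Xm}
    (hn : IsCanonicalIdentification K n) (g : (jordanPair K J).PE) {x : (jordanPair K J).Xp}
    (hx : (jordanPair K J).Transversal x
      ((transversal_smul (P := jordanPair K J) g).symmetry.trans n x)) :
    x ∈ (jordanPair K J).U (g • weyl K J • (jordanPair K J).om) (g • (jordanPair K J).om) := by
  have h1 := (polarity_spec hn (transversal_smul g) _ _ hx).2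
  obtain ⟨k, hk1, hk2, hk⟩ := hx.exists_smul
  rw [Equiv.symm_apply_apply, ← hk, euler_smul] at h1
  obtain ⟨m, hm⟩ := (g : TKK (jordanPair K J) ≃ₗ[K] TKK (jordanPair K J)).surjective
    ((k : TKK (jordanPair K J) ≃ₗ[K] TKK (jordanPair K J)) (eulerOp _))
  rw [← hm, reflection_map, ← map_neg, EmbeddingLike.apply_eq_iff_eq, reflection_eulerOp,
    gradeScale_neg_one] at h1
  obtain ⟨p, d, q⟩ := m
  have hd : d = 0 := by
    have h2 : d = -d := congrArg TKK.zero h1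
    apply smul_two_cancel (R := K)
    rw [two_smul, smul_zero]
    nth_rewrite 1 [h2]
    exact neg_add_cancel d
  subst hd
  have hh : ((g⁻¹ * k : (jordanPair K J).PE) :
      TKK (jordanPair K J) ≃ₗ[K] TKK (jordanPair K J)) (eulerOp _) = ⟨p, 0, q⟩ := by
    rw [PE.inv_mul_apply, LinearEquiv.symm_apply_eq, hm]
  have hD := two_smul_innerDer_of_odd _ hh
  have hp : (2 : K) • (jordanPair K J).Tp p q p = p :=
    DFunLike.congr_fun (congrArg (fun t => t.1.1) hD) p
  have hq : (2 : K) • (jordanPair K J).Tm q p q = q := by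
    have := DFunLike.congr_fun (congrArg (fun t => t.1.2) hD) q
    simpa using this
  -- the `-1` eigenspace of `m = (p, 0, q)` contains `E + p - q`
  obtain ⟨z, hz⟩ := ((g⁻¹ * k : (jordanPair K J).PE) :
    TKK (jordanPair K J) ≃ₗ[K] TKK (jordanPair K J)).surjective ⟨p, (eulerOp _).zero, -q⟩
  have hz' : z ∈ TKK.gradeNeg (jordanPair K J) := by
    rw [TKK.mem_gradeNeg_iff_lie]
    apply ((g⁻¹ * k : (jordanPair K J).PE) :
      TKK (jordanPair K J) ≃ₗ[K] TKK (jordanPair K J)).injective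
    rw [PE.map_lie, map_neg, hh, hz]
    have : (⟨p, (eulerOp (jordanPair K J)).zero, -q⟩ : TKK (jordanPair K J)) =
        eulerOp _ + ⟨p, 0, -q⟩ := by ext1 <;> simp
    rw [this, lie_add, lie_odd_eulerOp]
    ext1
    · simp
    · simp only [TKK.zero_add, TKK.zero_lie, TKK.zero_neg, ← hD]
      apply TKK.der_ext <;> intro v <;> simp [two_smul]
      abel
    · simp
  have hz0 : z = ofNeg _ z.neg := by
    ext1
    · exact hz'.1
    · exact hz'.2
    · rfl
  -- On this line, `s = 1` gives `g (E + 2p)` and `s = -1` gives `g (-E + 2q)`: Euler operators with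
  -- second entry `g o⁻ = b` and `g w o⁻ = a` respectively.
  have key : ∀ s : K, ((k * (jordanPair K J).uNeg (s • z.neg) : (jordanPair K J).PE) :
      TKK (jordanPair K J) ≃ₗ[K] TKK (jordanPair K J)) (eulerOp _) =
      (g : TKK (jordanPair K J) ≃ₗ[K] TKK (jordanPair K J))
        (⟨p, 0, q⟩ + s • ⟨p, (eulerOp _).zero, -q⟩) := by
    intro s
    have hs : ofNeg (jordanPair K J) (s • z.neg) = s • z := by
      nth_rewrite 2 [hz0]
      ext1 <;> simp
    rw [← hh, ← hz, PE.mul_apply, coe_uNeg, expNeg_eulerOp, hs, ← map_smul, ← map_add,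
      ← PE.mul_apply, mul_inv_cancel_left]
  have hop : ∀ y, (k * (jordanPair K J).uNeg y) • (jordanPair K J).op = x := by
    intro y
    rw [mul_smul, uNeg_smul_op, hk1]
  constructor
  · obtain ⟨u, hu⟩ := exists_weyl_ofPos (K := K) ((2 : K) • q)
    refine ⟨_, hop ((-1 : K) • z.neg), ?_⟩
    rw [← mul_smul g]
    refine (smul_om_eq_of_eulerOp_eq (x := u) ?_).symm
    rw [key, PE.mul_apply, map_add (weyl K J).1, weyl_eulerOp, hu]
    congr 1
    ext1 <;> simp [two_smul]
  · refine ⟨_, hop ((1 : K) • z.neg), ?_⟩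
    refine (smul_om_eq_of_eulerOp_eq (x := (2 : K) • p) ?_).symm
    rw [key]
    congr 1
    ext1 <;> simp [two_smul]

end PolarityOfPair

theorem theorem3p1 {K : Type*} [CommRing K] [Invertible (2 : K)] [Invertible (3 : K)]
    {Vp Vm : Type*} [AddCommGroup Vp] [AddCommGroup Vm] [Module K Vp] [Module K Vm]
    (P : LinearJordanPair K Vp Vm)
    (J : Type*) [NonAssocCommRing J] [IsCommJordan J] [Module K J] [IsScalarTower K J J]
    [SMulCommClass K J J] :
    -- `U_{a,b}` is a symmetric space
    (∀ a b : P.Xm, (P.U a b).Nonempty →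
      (∀ x ∈ P.U a b, P.Transversal x (P.midpointMap a b x)) ∧
      (∀ x ∈ P.U a b, ∀ y ∈ P.U a b, P.Transversal y (P.midpointMap a b x) →
        P.mul a b x y = P.piPos (-1) x (P.midpointMap a b x) y) ∧
      P.IsSymmetricSpace (P.U a b) (P.mul a b)) ∧
    -- the case of the Jordan pair `(J, J)` of a unital Jordan algebra `J`
    (∃ n : (jordanPair K J).Xp ≃ (jordanPair K J).Xm, IsCanonicalIdentification K n ∧
      ∀ a b : (jordanPair K J).Xm, (jordanPair K J).Transversal (n.symm a) b →
        -- the midpoint map extends to a polarity, whose symmetric space is `U_{a,b}`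
        (∃ f : (jordanPair K J).Xp ≃ (jordanPair K J).Xm, (jordanPair K J).IsPolarity f ∧
          (∀ x ∈ (jordanPair K J).U a b, f x = (jordanPair K J).midpointMap a b x) ∧
          (jordanPair K J).U a b = (jordanPair K J).polarSet f ∧
          ∀ x ∈ (jordanPair K J).U a b, ∀ y ∈ (jordanPair K J).U a b,
            (jordanPair K J).mul a b x y = (jordanPair K J).polarMul f x y) ∧
        -- an affine chart `J = V⁺ → 𝔳_b` restricts to an isomorphism `J^× → U_{a,b}`
        ∃ g : (jordanPair K J).PE, g • (jordanPair K J).om = b ∧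
          Set.BijOn ((jordanPair K J).chartPos g) (jordanUnits K J) ((jordanPair K J).U a b) ∧
          ∀ x ∈ jordanUnits K J, ∀ y ∈ jordanUnits K J, jordanMul K x y ∈ jordanUnits K J ∧
            (jordanPair K J).chartPos g (jordanMul K x y) =
              (jordanPair K J).mul a b ((jordanPair K J).chartPos g x)
                ((jordanPair K J).chartPos g y)) := by
  refine ⟨fun a b _ => ⟨fun x hx => (midpointMap_spec hx.1 hx.2).1,
    fun x hx y _ hy => dilation_neg_one_eq_piPos (midpointMap_spec hx.1 hx.2).1 hy,
    isSymmetricSpace_U a b⟩, canonicalIdentification K J,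
    isCanonicalIdentification_canonicalIdentification, ?_⟩
  have hn := isCanonicalIdentification_canonicalIdentification (K := K) (J := J)
  intro a b hab
  -- The element `g` carrying `(o⁺, o⁻)` to `(n⁻¹(a), b)` serves both as the chart and as the base
  -- of the polarity.
  obtain ⟨g, h1, rfl⟩ := hab
  have ha : a = g • weyl K J • (jordanPair K J).om := by
    rw [← hn, h1, Equiv.apply_symm_apply]
  subst ha
  have hb := bijOn_chartPos (K := K) (J := J) g
  have hp : ∀ x ∈ (jordanPair K J).U (g • weyl K J • (jordanPair K J).om)
      (g • (jordanPair K J).om), (transversal_smul (P := jordanPair K J) g).symmetry.trans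
        (canonicalIdentification K J) x = (jordanPair K J).midpointMap
          (g • weyl K J • (jordanPair K J).om) (g • (jordanPair K J).om) x := by
    intro x hx
    obtain ⟨v, hv, rfl⟩ := hb.surjOn hx
    exact polarity_eq_midpointMap hn g hv
  have hU : ∀ x ∈ (jordanPair K J).U (g • weyl K J • (jordanPair K J).om)
      (g • (jordanPair K J).om), (jordanPair K J).Transversal x
        ((transversal_smul (P := jordanPair K J) g).symmetry.trans
          (canonicalIdentification K J) x) := by
    intro x hx
    rw [hp x hx]
    exact (midpointMap_spec hx.1 hx.2).1
  -- The non-isotropic point required of a polarity is the image of the unit `1 ∈ J^×`.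
  refine ⟨⟨(transversal_smul (P := jordanPair K J) g).symmetry.trans
    (canonicalIdentification K J), isPolarity_of_euler _ (-reflection _)
      (polarity_spec hn (transversal_smul g)) ⟨_, hU _ (hb.mapsTo one_mem_jordanUnits)⟩, hp,
    Set.Subset.antisymm hU fun x hx => transversal_polarity_imp_mem_U hn g hx,
    fun x hx y _ => ?_⟩, g, rfl, hb, fun x hx y hy => chartPos_jordanMul g hx hy⟩
  rw [LinearJordanPair.mul, polarMul, hp x hx]
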